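/- For a Young diagram denoted by a capital Greek letter, the corresponding lowercase letter denotes the Young diagram obtained by deleting its first row, and $|\cdot|$ denotes the number of cells. For a Young diagram $\Lambda$ with $|\Lambda|=n$, the same letter denotes the irreducible complex representation (Specht module) of $S_n$ attached to it, one-row diagrams corresponding to trivial representations. For $|\Lambda|=|\Omega|=|\Sigma|=n$ let the Kronecker coefficient $k^{\Sigma}_{\Lambda,\Omega}=[\Sigma:\Lambda\otimes\Omega]$ be the multiplicity of $\Sigma$ in the $S_n$-representation $\Lambda\otimes\Omega$. For $|\sigma|=|\lambda|+|\omega|$ let the Littlewood–Richardson coefficient $c^{\sigma}_{\lambda,\omega}=[\sigma:\mathrm{Ind}_{S_{|\lambda|}\times S_{|\omega|}}^{S_{|\sigma|}}\lambda\boxtimes\omega]$ be the multiplicity of $\sigma$ in the induced representation. **Proposition 1.3.** Let $\Lambda$ and $\Omega$ be Young diagrams with $|\Lambda|=|\Omega|=n$ and suppose that $|\lambda|+|\omega|\le n/2$. Then: (a) For any Young diagram $\Sigma$ with $|\Sigma|=n$ whose first row is strictly shorter than $n-|\lambda|-|\omega|$, the Kronecker coefficient $k^{\Sigma}_{\Lambda,\Omega}$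 is zero. (b) For any Young diagram $\Sigma$ with $|\Sigma|=n$ whose first row has length equal to $n-|\lambda|-|\omega|$, one has $|\sigma|=|\lambda|+|\omega|$, and the Kronecker coefficient $k^{\Sigma}_{\Lambda,\Omega}$ equals the Littlewood–Richardson coefficient $c^{\sigma}_{\lambda,\omega}$. -/

import Mathlib

namespace YoungDiagram

/-! ### Deleting the first row of a Young diagram -/

/-- The Young diagram obtained from `μ` by deleting its first row (row `0`); cells are pairs
`(row, column)`. -/
def deleteFirstRow (μ : YoungDiagram) : YoungDiagram where
  cells := (μ.cells.filter fun c => 1 ≤ c.1).image fun c => (c.1 - 1, c.2)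
  isLowerSet := by
    rintro ⟨a, b⟩ ⟨c, d⟩ hle h
    simp only [Finset.coe_image, Set.mem_image, Finset.mem_coe, Finset.mem_filter,
      mem_cells, Prod.mk.injEq, Prod.exists] at h ⊢
    obtain ⟨i, j, ⟨hm, hi⟩, rfl, rfl⟩ := h
    have h1 : c ≤ i - 1 := hle.1
    have h2 : d ≤ j := hle.2
    exact ⟨c + 1, d, ⟨μ.up_left_mem (by omega) h2 hm, by omega⟩, by omega, rfl⟩

theorem mem_deleteFirstRow {μ : YoungDiagram} {i j : ℕ} :
    (i, j) ∈ μ.deleteFirstRow ↔ (i + 1, j) ∈ μ := by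
  rw [← mem_cells]
  simp only [deleteFirstRow, Finset.mem_image, Finset.mem_filter, mem_cells,
    Prod.mk.injEq, Prod.exists]
  constructor
  · rintro ⟨a, b, ⟨hm, ha⟩, rfl, rfl⟩
    rwa [Nat.sub_add_cancel ha]
  · intro h
    exact ⟨i + 1, j, ⟨h, by omega⟩, by omega, rfl⟩

/-! ### Specht modules

For a finite set `α`, the symmetric group of `α` is `Equiv.Perm α`.  A numbering of the diagram `μ`
by `α` (a tableau with entries in `α`, each used once) is a bijection `T : α ≃ μ.cells`, sending an
entry to the cell that contains it.  Everything below is meant for `#α = |μ|`; otherwise there are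
no numberings and the Specht module is zero. -/

/-- The tabloids of shape `μ` with entries in `α`, i.e. the row-equivalence classes of numberings:
a class is recorded by the function that sends an entry to the index of its row. -/
def Tabloid (μ : YoungDiagram) (α : Type) : Type :=
  {f : α → ℕ // ∃ T : α ≃ μ.cells, ∀ a, f a = (T a).1.1}

/-- The tabloid of a numbering. -/
def tabloid {μ : YoungDiagram} {α : Type} (T : α ≃ μ.cells) : Tabloid μ α :=
  ⟨fun a => (T a).1.1, T, fun _ => rfl⟩

/-- The symmetric group acts on tabloids by permuting the entries: `g • t` has the entry `g a` in
the row where `t` has the entry `a`. -/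
instance (μ : YoungDiagram) (α : Type) : MulAction (Equiv.Perm α) (Tabloid μ α) where
  smul g t := ⟨fun a => t.1 (g⁻¹ a), by
    obtain ⟨T, hT⟩ := t.2
    exact ⟨g⁻¹.trans T, fun a => hT _⟩⟩
  one_smul _ := rfl
  mul_smul _ _ _ := rfl

/-- The numbering `g T`, which has the entry `g a` in the cell where `T` has the entry `a`. -/
def permNumbering {μ : YoungDiagram} {α : Type} (g : Equiv.Perm α) (T : α ≃ μ.cells) :
    α ≃ μ.cells :=
  g⁻¹.trans T

theorem smul_tabloid {μ : YoungDiagram} {α : Type} (g : Equiv.Perm α) (T : α ≃ μ.cells) :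
    g • tabloid T = tabloid (permNumbering g T) :=
  rfl

/-- The permutation module `M^μ`: the complex vector space with basis the tabloids. -/
noncomputable abbrev permModule (μ : YoungDiagram) (α : Type) :
    Representation ℂ (Equiv.Perm α) (MonoidAlgebra ℂ (Tabloid μ α)) :=
  Representation.ofMulAction ℂ (Equiv.Perm α) (Tabloid μ α)

section Specht

variable {α : Type} [Fintype α] [DecidableEq α]

/-- The column group of a numbering: the permutations of the entries that preserve every
column. -/
def columnGroup {μ : YoungDiagram} (T : α ≃ μ.cells) : Finset (Equiv.Perm α) :=
  Finset.univ.filter fun q => ∀ a, (T (q a)).1.2 = (T a).1.2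

/-- The polytabloid `e_T = ∑ sign(q) {q T}`, the sum being over the column group of `T`. -/
noncomputable def polytabloid {μ : YoungDiagram} (T : α ≃ μ.cells) :
    MonoidAlgebra ℂ (Tabloid μ α) :=
  ∑ q ∈ columnGroup T,
    MonoidAlgebra.single (q • tabloid T) ((Equiv.Perm.sign q : ℤ) : ℂ)

/-- `g e_T = e_{g T}`. -/
theorem permModule_polytabloid {μ : YoungDiagram} (g : Equiv.Perm α) (T : α ≃ μ.cells) :
    permModule μ α g (polytabloid T) = polytabloid (permNumbering g T) := by
  unfold polytabloid
  rw [map_sum]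
  refine Finset.sum_bij' (fun q _ => g * q * g⁻¹) (fun q _ => g⁻¹ * q * g) ?_ ?_ ?_ ?_ ?_
  · intro q hq
    simp only [columnGroup, Finset.mem_filter, Finset.mem_univ, true_and] at hq ⊢
    intro a
    have h := hq (g⁻¹ a)
    simpa [permNumbering] using h
  · intro q hq
    simp only [columnGroup, Finset.mem_filter, Finset.mem_univ, true_and] at hq ⊢
    intro a
    have h := hq (g a)
    simpa [permNumbering] using h
  · intro q _
    group
  · intro q _
    group
  · intro q _
    rw [Representation.ofMulAction_single, ← smul_tabloid, smul_smul, smul_smul]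
    have hs : Equiv.Perm.sign (g * q * g⁻¹) = Equiv.Perm.sign q := by
      rw [map_mul, map_mul, map_inv, mul_right_comm, mul_inv_cancel, one_mul]
    rw [hs, inv_mul_cancel_right]

/-- The Specht module `S^μ` as a subrepresentation of `M^μ`: the span of all polytabloids. -/
noncomputable def spechtSub (μ : YoungDiagram) (α : Type) [Fintype α] [DecidableEq α] :
    Subrepresentation (permModule μ α) where
  toSubmodule := Submodule.span ℂ (Set.range fun T : α ≃ μ.cells => polytabloid T)
  apply_mem_toSubmodule g v hv := by
    have h : Submodule.span ℂ (Set.range fun T : α ≃ μ.cells => polytabloid T) ≤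
        (Submodule.span ℂ (Set.range fun T : α ≃ μ.cells => polytabloid T)).comap
          (permModule μ α g) := by
      rw [Submodule.span_le]
      rintro _ ⟨T, rfl⟩
      exact Submodule.subset_span ⟨permNumbering g T, (permModule_polytabloid g T).symm⟩
    exact h hv

/-- The Specht module `S^μ`, the complex irreducible representation of the symmetric group of `α`
attached to `μ` (for `#α = |μ|`); the trivial representation corresponds to one-row diagrams. -/
noncomputable def specht (μ : YoungDiagram) (α : Type) [Fintype α] [DecidableEq α] :
    Representation ℂ (Equiv.Perm α) (spechtSub μ α).toSubmodule :=
  (spechtSub μ α).toRepresentation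

end Specht

end YoungDiagram

/-! ### Multiplicities -/

/-- The multiplicity of the irreducible complex representation `σ` in the finite-dimensional complex
representation `ρ` of a finite group, `dim Hom_G(σ, ρ)`. -/
noncomputable def repMultiplicity {G V W : Type} [Group G] [AddCommMonoid V] [Module ℂ V]
    [AddCommMonoid W] [Module ℂ W] (σ : Representation ℂ G V) (ρ : Representation ℂ G W) : ℕ :=
  Module.finrank ℂ (Representation.IntertwiningMap σ ρ)

/-- The external tensor product of representations of `G` and `H`, a representation of `G × H`. -/
noncomputable def externalTensor {G H V W : Type} [Group G] [Group H] [AddCommMonoid V]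
    [Module ℂ V] [AddCommMonoid W] [Module ℂ W] (ρ : Representation ℂ G V)
    (τ : Representation ℂ H W) : Representation ℂ (G × H) (TensorProduct ℂ V W) :=
  Representation.tprod (ρ.comp (MonoidHom.fst G H)) (τ.comp (MonoidHom.snd G H))

/-- For diagrams `Λ`, `Ω`, `S` with `n` cells, the Kronecker coefficient: the multiplicity of `S` in
the representation `Λ ⊗ Ω` of the symmetric group on `n` letters. -/
noncomputable def kroneckerCoeff (n : ℕ) (Λ Ω S : YoungDiagram) : ℕ :=
  repMultiplicity (S.specht (Fin n)) (Representation.tprod (Λ.specht (Fin n)) (Ω.specht (Fin n)))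

/-- For diagrams with `|s| = |l| + |w|`, the Littlewood–Richardson coefficient: the multiplicity of
`s` in the representation induced from `l ⊠ w` along the inclusion of `S_{|l|} × S_{|w|}` in
`S_{|l| + |w|}`.  The latter group is the symmetric group of the disjoint union of the two sets of
letters, and the inclusion lets each factor permute its own letters. -/
noncomputable def littlewoodRichardsonCoeff (l w s : YoungDiagram) : ℕ :=
  repMultiplicity (s.specht (Fin l.card ⊕ Fin w.card))
    (Representation.ind
      (A := TensorProduct ℂ (l.spechtSub (Fin l.card)).toSubmodule
        (w.spechtSub (Fin w.card)).toSubmodule)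
      (Equiv.Perm.sumCongrHom (Fin l.card) (Fin w.card))
      (externalTensor (l.specht (Fin l.card)) (w.specht (Fin w.card))))

/-!
Let `λ` and `ω` be `Λ` and `Ω` without their first rows, `k = |λ| + |ω|`, and suppose `2 * k ≤ n`.
The idea is to choose `k` disjoint pairs among the `n` letters and to look, in a representation of
the symmetric group, at the vectors that change sign under every exchange of the two members of a
pair.  The symmetric group of the set of pairs acts on these vectors.

* A tabloid is fixed by all permutations that fix its entries below the first row.  So the
  antisymmetrizer `pairAlt` kills a tabloid of shape `Λ` unless every pair contains such an entry;
  for `|λ|` pairs, what survives is, up to sign, a tabloid of shape `λ` whose entries are the first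
  members of the pairs (`pairAlt_eq_zero_or`, `YoungDiagram.Tabloid.exists_lift_eq`).  Hence the
  pair-alternating vectors of `M^Λ` form a copy of `M^λ`, and those of `S^Λ` a copy of `S^λ`
  (`YoungDiagram.altLift_mem_spechtSub`, `YoungDiagram.exists_pairAlt_eq_altLift_of_mem`).
* In the same way, a tensor product of two tabloids of shapes `Λ` and `Ω` survives
  antisymmetrization over `k` pairs only if the two sets of entries below the first rows are
  complementary choices of one member from each pair.  The choice of the pairs that are met by the
  first tabloid is the choice of a coset of `S_{|λ|} × S_{|ω|}` in `S_k`, so the pair-alternating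
  vectors of `S^Λ ⊗ S^Ω` form the representation induced from `S^λ ⊠ S^ω`.
* If `Σ` has `k` cells below its first row, forming the diagram `σ`, then restriction to
  pair-alternating vectors is an isomorphism from the equivariant maps `S^Σ → S^Λ ⊗ S^Ω` to the
  equivariant maps from `S^σ` to that induced representation
  (`YoungDiagram.repMultiplicity_specht_eq`).  It is injective because `S^Σ` is irreducible.  It is
  surjective because a map on `S^σ` extends to `M^σ`, and then to `M^Σ`: a pair-alternating vector
  of `S^Λ ⊗ S^Ω` is the antisymmetrization of a vector fixed by all permutations that fix the first
  members of the pairs, and averaging it makes it a possible image of a tabloid of shape `Σ`.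

Together these give the Littlewood–Richardson coefficient
(`YoungDiagram.repMultiplicity_tprod_specht_eq`).  If the first row of `Σ` is shorter than `n - k`,
then there are, for every pair of tabloids of shapes `Λ` and `Ω` and every numbering of `Σ`, two
letters in one column of the numbering that stand in the first rows of both tabloids.  Their
transposition negates the polytabloid and fixes both tabloids, so an equivariant map takes the
polytabloid to a vector whose coefficients all vanish
(`YoungDiagram.repMultiplicity_tprod_specht_eq_zero`).
-/

open Equiv

/-! ### Averaging -/

section Averaging

variable {G V : Type} [Group G] [Fintype G] [AddCommGroup V] [Module ℂ V]

/-- Maschke's theorem, as an equivariant projection onto a subrepresentation. -/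
theorem Subrepresentation.exists_equivariant_retraction {ρ : Representation ℂ G V}
    (S : Subrepresentation ρ) :
    ∃ p : V →ₗ[ℂ] S.toSubmodule,
      (∀ g v, p (ρ g v) = S.toRepresentation g (p v)) ∧ ∀ v : S.toSubmodule, p v = v := by
  obtain ⟨r, hr⟩ := S.toSubmodule.subtype.exists_leftInverse_of_injective
    (LinearMap.ker_eq_bot.2 S.toSubmodule.injective_subtype)
  have hr' : ∀ v : S.toSubmodule, r v = v := fun v => LinearMap.congr_fun hr v
  have hG : (Fintype.card G : ℂ) ≠ 0 := by exact_mod_cast Fintype.card_ne_zero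
  refine ⟨(Fintype.card G : ℂ)⁻¹ • ∑ h : G, S.toRepresentation h ∘ₗ r ∘ₗ ρ h⁻¹, ?_, ?_⟩
  · intro g v
    simp only [LinearMap.smul_apply, LinearMap.sum_apply, LinearMap.comp_apply, map_smul, map_sum]
    congr 1
    refine Fintype.sum_equiv (Equiv.mulLeft g⁻¹) _ _ fun h => ?_
    simp only [← Module.End.mul_apply, ← map_mul, Equiv.coe_mulLeft]
    simp
  · intro v
    have h1 : ∀ h : G, S.toRepresentation h (r (ρ h⁻¹ v)) = v := by
      intro h
      have : ρ h⁻¹ v = (S.toRepresentation h⁻¹ v : S.toSubmodule) := rfl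
      rw [this, hr', ← Module.End.mul_apply, ← map_mul]
      simp
    simp only [LinearMap.smul_apply, LinearMap.sum_apply, LinearMap.comp_apply]
    rw [Finset.sum_congr rfl fun h _ => h1 h]
    simp only [Finset.sum_const, Finset.card_univ, ← Nat.cast_smul_eq_nsmul ℂ, smul_smul]
    rw [inv_mul_cancel₀ hG, one_smul]

end Averaging

/-! ### Antisymmetrization over disjoint pairs -/

theorem sign_mul_self_cast {N : Type} [Fintype N] [DecidableEq N] (g : Perm N) :
    ((Perm.sign g : ℤ) : ℂ) * ((Perm.sign g : ℤ) : ℂ) = 1 := by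
  rw [← Int.cast_mul, ← Units.val_mul, Int.units_mul_self]
  simp

section Pairs

variable {K N : Type}

/-- A family of disjoint pairs of letters of `N` indexed by `K` is an embedding `e` of `K × ℤˣ`.
`pairSwap e ε` exchanges the two members `e (i, 1)` and `e (i, -1)` of the `i`-th pair whenever
`ε i = -1`, and fixes all other letters. -/
noncomputable def pairSwap (e : K × ℤˣ ↪ N) : (K → ℤˣ) →* Perm N :=
  (Perm.viaEmbeddingHom e).comp
    { toFun := fun ε => prodCongrRight fun i => Equiv.mulLeft (ε i)
      map_one' := by ext x <;> simp
      map_mul' := fun ε δ => by ext x <;> simp }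

/-- The first members of the pairs. -/
def pairFst (e : K × ℤˣ ↪ N) : K ↪ N :=
  ⟨fun i => e (i, 1), fun _ _ h => congrArg Prod.fst (e.injective h)⟩

theorem pairFst_apply (e : K × ℤˣ ↪ N) (i : K) : pairFst e i = e (i, 1) := rfl

/-- The permutation of the letters of `N` that permutes the pairs by `π`. -/
noncomputable def pairPerm (e : K × ℤˣ ↪ N) : Perm K →* Perm N :=
  (Perm.viaEmbeddingHom e).comp
    { toFun := fun π => prodCongr π (Equiv.refl ℤˣ)
      map_one' := by ext x <;> simp
      map_mul' := fun ε δ => by ext x <;> simp }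

theorem pairSwap_apply (e : K × ℤˣ ↪ N) (ε : K → ℤˣ) (i : K) (u : ℤˣ) :
    pairSwap e ε (e (i, u)) = e (i, ε i * u) := by
  simp [pairSwap, Perm.viaEmbeddingHom_apply, Perm.viaEmbedding_apply]

theorem pairSwap_apply_of_notMem (e : K × ℤˣ ↪ N) (ε : K → ℤˣ) {a : N} (h : a ∉ Set.range e) :
    pairSwap e ε a = a := by
  simp [pairSwap, Perm.viaEmbeddingHom_apply, Perm.viaEmbedding_apply_of_notMem _ _ _ h]

theorem pairPerm_apply (e : K × ℤˣ ↪ N) (π : Perm K) (i : K) (u : ℤˣ) :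
    pairPerm e π (e (i, u)) = e (π i, u) := by
  simp [pairPerm, Perm.viaEmbeddingHom_apply, Perm.viaEmbedding_apply]

theorem pairPerm_apply_of_notMem (e : K × ℤˣ ↪ N) (π : Perm K) {a : N} (h : a ∉ Set.range e) :
    pairPerm e π a = a := by
  simp [pairPerm, Perm.viaEmbeddingHom_apply, Perm.viaEmbedding_apply_of_notMem _ _ _ h]

variable [Fintype K] [DecidableEq K] [Fintype N] [DecidableEq N]

theorem sign_pairSwap (e : K × ℤˣ ↪ N) (ε : K → ℤˣ) :
    Perm.sign (pairSwap e ε) = ∏ i, ε i := by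
  have hs : ∀ u : ℤˣ, Perm.sign (Equiv.mulLeft u : Perm ℤˣ) = u := by decide
  simp only [pairSwap, MonoidHom.comp_apply, MonoidHom.coe_mk, OneHom.coe_mk,
    Perm.viaEmbeddingHom_apply, Perm.viaEmbedding, Perm.sign_extendDomain,
    Perm.sign_prodCongrRight, hs]

theorem pairPerm_mul_pairSwap {K N : Type} (e : K × ℤˣ ↪ N) (π : Perm K) (ε : K → ℤˣ) :
    pairPerm e π * pairSwap e ε = pairSwap e (ε ∘ π.symm) * pairPerm e π := by
  ext a
  by_cases h : a ∈ Set.range e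
  · obtain ⟨⟨i, u⟩, rfl⟩ := h
    simp [pairSwap_apply, pairPerm_apply]
  · simp [pairSwap_apply_of_notMem e _ h, pairPerm_apply_of_notMem e _ h]

variable {V W : Type} [AddCommMonoid V] [Module ℂ V] [AddCommMonoid W] [Module ℂ W]

/-- The signed sum of the operators `pairSwap e ε`: it is a nonzero multiple of the projection onto
the vectors that change sign under every exchange of the two members of a pair. -/
noncomputable def pairAlt (ρ : Representation ℂ (Perm N) V) (e : K × ℤˣ ↪ N) : V →ₗ[ℂ] V :=
  ∑ ε : K → ℤˣ, ((Perm.sign (pairSwap e ε) : ℤ) : ℂ) • ρ (pairSwap e ε)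

/-- The vectors that change sign under every exchange of the two members of a pair. -/
def IsPairAlternating (ρ : Representation ℂ (Perm N) V) (e : K × ℤˣ ↪ N) (v : V) : Prop :=
  ∀ ε, ρ (pairSwap e ε) v = ((Perm.sign (pairSwap e ε) : ℤ) : ℂ) • v

theorem pairAlt_apply (ρ : Representation ℂ (Perm N) V) (e : K × ℤˣ ↪ N) (v : V) :
    pairAlt ρ e v =
      ∑ ε : K → ℤˣ, ((Perm.sign (pairSwap e ε) : ℤ) : ℂ) • ρ (pairSwap e ε) v := by
  simp [pairAlt]

theorem pairAlt_pairSwap (ρ : Representation ℂ (Perm N) V) (e : K × ℤˣ ↪ N) (δ : K → ℤˣ) (v : V) :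
    pairAlt ρ e (ρ (pairSwap e δ) v) = ((Perm.sign (pairSwap e δ) : ℤ) : ℂ) • pairAlt ρ e v := by
  simp only [pairAlt_apply, Finset.smul_sum, smul_smul]
  refine Fintype.sum_equiv (Equiv.mulRight δ) _ _ fun ε => ?_
  simp only [Equiv.coe_mulRight, map_mul, Units.val_mul, Int.cast_mul, Module.End.mul_apply]
  congr 1
  rw [mul_comm, mul_assoc, sign_mul_self_cast, mul_one]

theorem isPairAlternating_pairAlt (ρ : Representation ℂ (Perm N) V) (e : K × ℤˣ ↪ N) (v : V) :
    IsPairAlternating ρ e (pairAlt ρ e v) := by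
  intro δ
  simp only [pairAlt_apply, Finset.smul_sum, smul_smul, map_sum, map_smul]
  refine Fintype.sum_equiv (Equiv.mulLeft δ) _ _ fun ε => ?_
  simp only [Equiv.coe_mulLeft, map_mul, Units.val_mul, Int.cast_mul, Module.End.mul_apply]
  congr 1
  rw [← mul_assoc, sign_mul_self_cast, one_mul]

theorem IsPairAlternating.pairAlt_eq {ρ : Representation ℂ (Perm N) V} {e : K × ℤˣ ↪ N} {v : V}
    (h : IsPairAlternating ρ e v) :
    pairAlt ρ e v = (Fintype.card (K → ℤˣ) : ℂ) • v := by
  rw [pairAlt_apply, Finset.sum_congr rfl fun ε _ => by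
    rw [h ε, smul_smul, sign_mul_self_cast, one_smul]]
  simp [← Nat.cast_smul_eq_nsmul ℂ]

/-- A vector that alternates in the pairs is in the image of the antisymmetrizer. -/
theorem IsPairAlternating.exists_pairAlt_eq {ρ : Representation ℂ (Perm N) V} {e : K × ℤˣ ↪ N}
    {v : V} (h : IsPairAlternating ρ e v) : ∃ w, pairAlt ρ e w = v := by
  refine ⟨(Fintype.card (K → ℤˣ) : ℂ)⁻¹ • v, ?_⟩
  rw [map_smul, h.pairAlt_eq, smul_smul, inv_mul_cancel₀, one_smul]
  exact_mod_cast Fintype.card_ne_zero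

theorem sign_pairSwap_comp (e : K × ℤˣ ↪ N) (π : Perm K) (ε : K → ℤˣ) :
    Perm.sign (pairSwap e (ε ∘ π)) = Perm.sign (pairSwap e ε) := by
  rw [sign_pairSwap, sign_pairSwap]
  exact Equiv.prod_comp π ε

theorem IsPairAlternating.pairPerm {ρ : Representation ℂ (Perm N) V} {e : K × ℤˣ ↪ N} {v : V}
    (h : IsPairAlternating ρ e v) (π : Perm K) :
    IsPairAlternating ρ e (ρ (pairPerm e π) v) := by
  intro ε
  have h1 : pairSwap e ε * _root_.pairPerm e π = _root_.pairPerm e π * pairSwap e (ε ∘ π) := by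
    rw [pairPerm_mul_pairSwap]
    congr 3
    ext i
    simp
  rw [← Module.End.mul_apply, ← map_mul, h1, map_mul, Module.End.mul_apply, h, map_smul,
    sign_pairSwap_comp]

theorem pairAlt_pairPerm (ρ : Representation ℂ (Perm N) V) (e : K × ℤˣ ↪ N) (π : Perm K) (v : V) :
    pairAlt ρ e (ρ (pairPerm e π) v) = ρ (pairPerm e π) (pairAlt ρ e v) := by
  simp only [pairAlt_apply, map_sum, map_smul]
  symm
  refine Fintype.sum_equiv (Equiv.arrowCongr π (Equiv.refl ℤˣ)) _ _ fun ε => ?_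
  have h := pairPerm_mul_pairSwap e π ε
  have h2 : Perm.sign (pairSwap e (ε ∘ π.symm)) = Perm.sign (pairSwap e ε) :=
    sign_pairSwap_comp e π.symm ε
  have h3 : (Equiv.arrowCongr π (Equiv.refl ℤˣ)) ε = ε ∘ π.symm := rfl
  rw [h3, h2, ← Module.End.mul_apply, ← Module.End.mul_apply, ← map_mul, ← map_mul, h]

theorem map_pairAlt {ρ : Representation ℂ (Perm N) V} {τ : Representation ℂ (Perm N) W}
    (f : V →ₗ[ℂ] W) (hf : ∀ g v, f (ρ g v) = τ g (f v)) (e : K × ℤˣ ↪ N) (v : V) :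
    f (pairAlt ρ e v) = pairAlt τ e (f v) := by
  simp only [pairAlt_apply, map_sum, map_smul, hf]

/-- The vectors fixed by all permutations that fix the letters `x i`. -/
def letterFixed (ρ : Representation ℂ (Perm N) V) (x : K ↪ N) : Submodule ℂ V where
  carrier := {v | ∀ g : Perm N, (∀ i, g (x i) = x i) → ρ g v = v}
  zero_mem' _ _ := map_zero _
  add_mem' hv hw g hg := by rw [map_add, hv g hg, hw g hg]
  smul_mem' c v hv g hg := by rw [map_smul, hv g hg]

/-- The antisymmetrizer kills a vector unless its support meets every pair; in that case, if the
support has at most as many letters as there are pairs, it consists of one letter from each pair,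
and exchanging within the pairs moves it onto the first members. -/
theorem pairAlt_eq_zero_or {V : Type} [AddCommGroup V] [Module ℂ V]
    (ρ : Representation ℂ (Perm N) V) (e : K × ℤˣ ↪ N) (v : V)
    (L : Finset N) (hL : L.card ≤ Fintype.card K)
    (hv : ∀ g : Perm N, (∀ a ∈ L, g a = a) → ρ g v = v) :
    pairAlt ρ e v = 0 ∨ ∃ ε : K → ℤˣ,
      pairAlt ρ e v = ((Perm.sign (pairSwap e ε) : ℤ) : ℂ) • pairAlt ρ e (ρ (pairSwap e ε) v) ∧
      (∀ a ∈ L, ∃ i, pairSwap e ε a = e (i, 1)) ∧ ∀ i, ∃ a ∈ L, pairSwap e ε a = e (i, 1) := by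
  by_cases h : ∃ i, ∀ u, e (i, u) ∉ L
  · left
    obtain ⟨i, hi⟩ := h
    have h1 : ρ (pairSwap e (Pi.mulSingle i (-1))) v = v := by
      refine hv _ fun a ha => ?_
      by_cases hr : a ∈ Set.range e
      · obtain ⟨⟨j, u⟩, rfl⟩ := hr
        have hj : j ≠ i := by rintro rfl; exact hi u ha
        rw [pairSwap_apply, Pi.mulSingle_eq_of_ne hj, one_mul]
      · exact pairSwap_apply_of_notMem e _ hr
    have h2 := pairAlt_pairSwap ρ e (Pi.mulSingle i (-1)) v
    rw [h1, sign_pairSwap, Finset.prod_pi_mulSingle'] at h2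
    simp only [Finset.mem_univ, if_true, Units.val_neg, Units.val_one, Int.cast_neg, Int.cast_one,
      neg_smul, one_smul] at h2
    have h3 : (2 : ℂ) • pairAlt ρ e v = 0 := by
      rw [two_smul]; nth_rewrite 1 [h2]; simp
    exact (smul_eq_zero.1 h3).resolve_left two_ne_zero
  · right
    push Not at h
    choose u hu using h
    have hinj : Function.Injective fun i => e (i, u i) := fun i j hij =>
      congrArg Prod.fst (e.injective hij)
    have himg : Finset.univ.image (fun i => e (i, u i)) = L := by
      refine Finset.eq_of_subset_of_card_le ?_ ?_
      · intro a ha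
        obtain ⟨i, -, rfl⟩ := Finset.mem_image.1 ha
        exact hu i
      · rw [Finset.card_image_of_injective _ hinj]
        simpa using hL
    have hswap : ∀ i, pairSwap e u (e (i, u i)) = e (i, 1) := fun i => by
      rw [pairSwap_apply, Int.units_mul_self]
    refine ⟨u, ?_, fun a ha => ?_, fun i => ⟨_, hu i, hswap i⟩⟩
    · rw [pairAlt_pairSwap, smul_smul, sign_mul_self_cast, one_smul]
    · rw [← himg] at ha
      obtain ⟨i, -, rfl⟩ := Finset.mem_image.1 ha
      exact ⟨i, hswap i⟩

end Pairs

namespace YoungDiagram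

/-! ### Tabloids -/

theorem rowLen_deleteFirstRow (μ : YoungDiagram) (r : ℕ) :
    μ.deleteFirstRow.rowLen r = μ.rowLen (r + 1) := by
  refine eq_of_forall_lt_iff fun j => ?_
  rw [← mem_iff_lt_rowLen, ← mem_iff_lt_rowLen, mem_deleteFirstRow]

theorem rowLen_zero_add_card_deleteFirstRow (μ : YoungDiagram) :
    μ.rowLen 0 + μ.deleteFirstRow.card = μ.card := by
  have h1 : μ.deleteFirstRow.card = (μ.cells.filter fun c => 1 ≤ c.1).card := by
    refine Finset.card_image_of_injOn ?_
    rintro ⟨a, b⟩ h1 ⟨c, d⟩ h2 h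
    simp only [Finset.coe_filter, Set.mem_ofPred_eq] at h1 h2
    simp only [Prod.mk.injEq] at h ⊢
    omega
  have h2 : μ.row 0 = μ.cells.filter fun c => ¬ 1 ≤ c.1 := by
    ext c
    rw [mem_row_iff, Finset.mem_filter, mem_cells]
    simp
  rw [rowLen_eq_card, h1, h2, add_comm]
  exact Finset.card_filter_add_card_filter_not _

section

variable {μ : YoungDiagram} {α : Type}

noncomputable instance [Finite α] : Fintype (Tabloid μ α) :=
  @Fintype.ofFinite _ <|
  Finite.of_surjective (fun T : α ≃ μ.cells => tabloid T) fun ⟨_, T, hT⟩ =>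
    ⟨T, Subtype.ext (funext fun a => (hT a).symm)⟩

theorem Tabloid.ext {s t : Tabloid μ α} (h : ∀ a, s.1 a = t.1 a) : s = t :=
  Subtype.ext (funext h)

theorem Tabloid.exists_eq_tabloid (t : Tabloid μ α) : ∃ T : α ≃ μ.cells, t = tabloid T := by
  obtain ⟨f, T, hT⟩ := t
  exact ⟨T, Subtype.ext (funext hT)⟩

theorem Tabloid.smul_val (g : Perm α) (t : Tabloid μ α) (a : α) : (g • t).1 a = t.1 (g.symm a) :=
  rfl

theorem Tabloid.exists_smul_eq (s t : Tabloid μ α) : ∃ g : Perm α, g • s = t := by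
  obtain ⟨S, rfl⟩ := s.exists_eq_tabloid
  obtain ⟨T, rfl⟩ := t.exists_eq_tabloid
  refine ⟨S.trans T.symm, ?_⟩
  rw [smul_tabloid]
  congr 1
  ext a
  · simp [permNumbering, Perm.inv_def]
  · simp [permNumbering, Perm.inv_def]

/-- A function is a tabloid exactly if its fibres have the sizes of the rows. -/
theorem exists_numbering_iff [Fintype α] (f : α → ℕ) :
    (∃ T : α ≃ μ.cells, ∀ a, f a = (T a).1.1) ↔
      ∀ r, (Finset.univ.filter fun a => f a = r).card = μ.rowLen r := by
  have hrow : ∀ r, Fintype.card {c : μ.cells // c.1.1 = r} = μ.rowLen r := by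
    intro r
    rw [rowLen_eq_card, Fintype.card_subtype]
    refine Finset.card_bij (fun c _ => c.1) ?_ ?_ ?_
    · intro c hc
      exact mem_row_iff.2 ⟨c.2, (Finset.mem_filter.1 hc).2⟩
    · intro c _ d _ h
      exact Subtype.ext h
    · intro c hc
      rw [mem_row_iff] at hc
      exact ⟨⟨c, hc.1⟩, by simp [hc.2], rfl⟩
  constructor
  · rintro ⟨T, hT⟩ r
    rw [← hrow, ← Fintype.card_subtype]
    exact Fintype.card_congr (T.subtypeEquiv fun a => by rw [hT])
  · intro h
    have he : ∀ r, Nonempty ({a // f a = r} ≃ {c : μ.cells // c.1.1 = r}) := fun r =>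
      ⟨Fintype.equivOfCardEq (by rw [hrow, Fintype.card_subtype, h])⟩
    exact ⟨Equiv.ofFiberEquiv (g := fun c : μ.cells => c.1.1) fun r => (he r).some, fun a =>
      (Equiv.ofFiberEquiv_map (g := fun c : μ.cells => c.1.1) (fun r => (he r).some) a).symm⟩

theorem Tabloid.card_fiber [Fintype α] (t : Tabloid μ α) (r : ℕ) :
    (Finset.univ.filter fun a => t.1 a = r).card = μ.rowLen r :=
  (exists_numbering_iff t.1).1 t.2 r

theorem Tabloid.card_eq [Fintype α] (t : Tabloid μ α) : Fintype.card α = μ.card := by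
  obtain ⟨T, -⟩ := t.2
  rw [Fintype.card_congr T, Fintype.card_coe]

/-- The entries of a tabloid below its first row. -/
def Tabloid.lower [Fintype α] (t : Tabloid μ α) : Finset α :=
  Finset.univ.filter fun a => t.1 a ≠ 0

theorem Tabloid.mem_lower [Fintype α] {t : Tabloid μ α} {a : α} : a ∈ t.lower ↔ t.1 a ≠ 0 := by
  simp [Tabloid.lower]

theorem Tabloid.card_lower [Fintype α] (t : Tabloid μ α) :
    t.lower.card = μ.deleteFirstRow.card := by
  have h1 := t.card_fiber 0
  have h2 := Finset.card_filter_add_card_filter_not (s := Finset.univ) (fun a => t.1 a = 0)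
  have h3 := t.card_eq
  have h4 := μ.rowLen_zero_add_card_deleteFirstRow
  rw [Finset.card_univ] at h2
  unfold Tabloid.lower
  simp only [ne_eq]
  omega

theorem Tabloid.smul_mem_lower [Fintype α] {t : Tabloid μ α} (g : Perm α) {a : α} :
    g a ∈ (g • t).lower ↔ a ∈ t.lower := by
  rw [mem_lower, mem_lower, smul_val, Equiv.symm_apply_apply]

theorem Tabloid.smul_eq_self [Fintype α] {t : Tabloid μ α} {g : Perm α}
    (hg : ∀ a ∈ t.lower, g a = a) : g • t = t := by
  refine Tabloid.ext fun a => ?_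
  rw [smul_val]
  obtain ⟨b, rfl⟩ := g.surjective a
  rw [Equiv.symm_apply_apply]
  by_cases hb : b ∈ t.lower
  · rw [hg b hb]
  by_cases hb' : g b ∈ t.lower
  · exact absurd (g.injective (hg _ hb') ▸ hb') hb
  rw [mem_lower, not_not] at hb hb'
  rw [hb, hb']

theorem Tabloid.smul_congr [Fintype α] {t : Tabloid μ α} {g g' : Perm α}
    (hg : ∀ a ∈ t.lower, g a = g' a) : g • t = g' • t := by
  rw [← inv_smul_eq_iff, smul_smul]
  refine Tabloid.smul_eq_self fun a ha => ?_
  rw [Perm.mul_apply, Perm.inv_def, symm_apply_eq, hg a ha]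

/-! ### Adding and deleting the first row of a tabloid -/

variable {K N : Type} [Fintype K] [Fintype N]

/-- A tabloid of the shape `μ` without its first row, with entries in `K`, becomes a tabloid of
shape `μ` with entries in `N` by renaming the entries along `x : K ↪ N` and putting all other
letters in a new first row. -/
noncomputable def Tabloid.lift (hN : μ.card = Fintype.card N) (x : K ↪ N)
    (t : Tabloid μ.deleteFirstRow K) : Tabloid μ N :=
  ⟨Function.extend x (fun i => t.1 i + 1) fun _ => 0, by
    rw [exists_numbering_iff]
    have h2 : ∀ r, (Finset.univ.filter fun a =>
        Function.extend x (fun i => t.1 i + 1) (fun _ => 0) a = r + 1).card = μ.rowLen (r + 1) := by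
      intro r
      rw [← rowLen_deleteFirstRow, ← t.card_fiber r, ← Finset.card_map x]
      congr 1
      ext a
      simp only [Finset.mem_filter, Finset.mem_univ, true_and, Finset.mem_map]
      by_cases ha : ∃ i, x i = a
      · obtain ⟨i, rfl⟩ := ha
        simp [x.injective.extend_apply]
      · rw [Function.extend_apply' _ _ _ ha]
        simp only [(Nat.succ_ne_zero r).symm, false_iff]
        rintro ⟨i, -, hi⟩
        exact ha ⟨i, hi⟩
    rintro (_ | r)
    · have h1 : (Finset.univ.filter fun a =>
          ¬ Function.extend x (fun i => t.1 i + 1) (fun _ => 0) a = 0) = Finset.univ.map x := by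
        ext a
        simp only [Finset.mem_filter, Finset.mem_univ, true_and, Finset.mem_map]
        by_cases ha : ∃ i, x i = a
        · obtain ⟨i, rfl⟩ := ha
          simp [x.injective.extend_apply]
        · rw [Function.extend_apply' _ _ _ ha]
          simpa using ha
      have h3 := Finset.card_filter_add_card_filter_not (s := Finset.univ) (fun a =>
        Function.extend x (fun i => t.1 i + 1) (fun _ => 0) a = 0)
      rw [h1, Finset.card_map, Finset.card_univ, Finset.card_univ, t.card_eq] at h3
      have h4 := μ.rowLen_zero_add_card_deleteFirstRow
      omega
    · exact h2 r⟩

variable (hN : μ.card = Fintype.card N) (x : K ↪ N)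

theorem Tabloid.lift_val (t : Tabloid μ.deleteFirstRow K) :
    (t.lift hN x).1 = Function.extend x (fun i => t.1 i + 1) fun _ => 0 := rfl

theorem Tabloid.lift_apply (t : Tabloid μ.deleteFirstRow K) (i : K) :
    (t.lift hN x).1 (x i) = t.1 i + 1 :=
  Eq.trans (congrFun (t.lift_val hN x) _) (x.injective.extend_apply _ _ _)

theorem Tabloid.lift_apply_of_notMem (t : Tabloid μ.deleteFirstRow K) {a : N}
    (ha : a ∉ Set.range x) : (t.lift hN x).1 a = 0 :=
  Eq.trans (congrFun (t.lift_val hN x) _) (Function.extend_apply' _ _ _ ha)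

theorem Tabloid.lift_injective : Function.Injective (Tabloid.lift (μ := μ) hN x) := by
  intro s t h
  refine Tabloid.ext fun i => ?_
  have := congrArg (fun u : Tabloid μ N => u.1 (x i)) h
  simpa [lift_apply] using this

theorem Tabloid.mem_lower_lift {t : Tabloid μ.deleteFirstRow K} {a : N} :
    a ∈ (t.lift hN x).lower ↔ a ∈ Set.range x := by
  rw [mem_lower]
  constructor
  · intro h
    by_contra h'
    exact h (lift_apply_of_notMem hN x t h')
  · rintro ⟨i, rfl⟩
    rw [lift_apply]
    exact Nat.succ_ne_zero _

theorem Tabloid.smul_lift {g : Perm N} {π : Perm K} (hg : ∀ i, g (x i) = x (π i))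
    (t : Tabloid μ.deleteFirstRow K) : g • t.lift hN x = (π • t).lift hN x := by
  refine Tabloid.ext fun a => ?_
  by_cases ha : a ∈ Set.range x
  · obtain ⟨i, rfl⟩ := ha
    have h1 : g.symm (x i) = x (π.symm i) := by
      rw [Equiv.symm_apply_eq, hg, Equiv.apply_symm_apply]
    rw [lift_apply, smul_val, smul_val, h1, lift_apply]
  · have h1 : g.symm a ∉ Set.range x := by
      rintro ⟨i, hi⟩
      refine ha ⟨π i, ?_⟩
      rw [← hg, hi, Equiv.apply_symm_apply]
    rw [lift_apply_of_notMem _ _ _ ha, smul_val, lift_apply_of_notMem _ _ _ h1]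

/-- A tabloid whose entries below the first row are among the `x i` is a lift. -/
theorem Tabloid.exists_lift_eq (hK : Fintype.card K = μ.deleteFirstRow.card) (s : Tabloid μ N)
    (hs : ∀ a ∈ s.lower, a ∈ Set.range x) : ∃ t, Tabloid.lift hN x t = s := by
  have hl : s.lower = Finset.univ.map x := by
    refine Finset.eq_of_subset_of_card_le (fun a ha => ?_) ?_
    · obtain ⟨i, rfl⟩ := hs a ha
      simp
    · rw [Finset.card_map, card_lower, Finset.card_univ, hK]
  have hx : ∀ i, s.1 (x i) ≠ 0 := fun i => by
    rw [← mem_lower, hl]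
    simp
  obtain ⟨t, ht⟩ : ∃ t : Tabloid μ.deleteFirstRow K, ∀ i, t.1 i = s.1 (x i) - 1 := by
    refine ⟨⟨fun i => s.1 (x i) - 1, ?_⟩, fun _ => rfl⟩
    rw [exists_numbering_iff]
    intro r
    rw [rowLen_deleteFirstRow, ← s.card_fiber, ← Finset.card_map x]
    congr 1
    ext a
    simp only [Finset.mem_filter, Finset.mem_univ, true_and, Finset.mem_map]
    constructor
    · rintro ⟨i, hi, rfl⟩
      have := hx i
      omega
    · intro h
      obtain ⟨i, rfl⟩ := hs a (by rw [mem_lower]; omega)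
      exact ⟨i, by omega, rfl⟩
  refine ⟨t, Tabloid.ext fun a => ?_⟩
  by_cases ha : a ∈ Set.range x
  · obtain ⟨i, rfl⟩ := ha
    rw [lift_apply, ht]
    have := hx i
    omega
  · rw [lift_apply_of_notMem _ _ _ ha]
    by_contra h
    exact ha (hs a (mem_lower.2 (Ne.symm h)))

end

/-! ### The permutation modules -/

section

variable {μ : YoungDiagram} {α K N : Type}

/-- The basis of `M^μ` formed by the tabloids. -/
noncomputable def permBasis (μ : YoungDiagram) (α : Type) :
    Module.Basis (Tabloid μ α) ℂ (MonoidAlgebra ℂ (Tabloid μ α)) :=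
  .ofRepr (MonoidAlgebra.coeffLinearEquiv ℂ)

theorem permBasis_apply (t : Tabloid μ α) : permBasis μ α t = MonoidAlgebra.single t 1 := rfl

theorem permBasis_repr (v : MonoidAlgebra ℂ (Tabloid μ α)) (t : Tabloid μ α) :
    (permBasis μ α).repr v t = v.coeff t := rfl

theorem permModule_permBasis (g : Perm α) (t : Tabloid μ α) :
    permModule μ α g (permBasis μ α t) = permBasis μ α (g • t) := by
  rw [permBasis_apply, permBasis_apply, Representation.ofMulAction_single]

theorem permBasis_coeff_self (t : Tabloid μ α) : (permBasis μ α t).coeff t = 1 := by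
  simp [permBasis_apply]

theorem permBasis_coeff_of_ne {s t : Tabloid μ α} (h : s ≠ t) :
    (permBasis μ α s).coeff t = 0 := by
  simp [permBasis_apply, h]

theorem coeff_sum_smul {ι : Type} (s : Finset ι) (c : ι → ℂ)
    (f : ι → MonoidAlgebra ℂ (Tabloid μ α)) (t : Tabloid μ α) :
    (∑ i ∈ s, c i • f i).coeff t = ∑ i ∈ s, c i * (f i).coeff t := by
  simp

theorem polytabloid_eq [Fintype α] [DecidableEq α] (T : α ≃ μ.cells) :
    polytabloid T = ∑ q ∈ columnGroup T,
      ((Perm.sign q : ℤ) : ℂ) • permBasis μ α (q • tabloid T) := by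
  refine Finset.sum_congr rfl fun q _ => ?_
  rw [permBasis_apply, MonoidAlgebra.smul_single, smul_eq_mul, mul_one]

variable [Fintype K] [Fintype N] (hN : μ.card = Fintype.card N) (x : K ↪ N)

/-- The linear extension of `Tabloid.lift`. -/
noncomputable def liftMap : MonoidAlgebra ℂ (Tabloid μ.deleteFirstRow K) →ₗ[ℂ]
    MonoidAlgebra ℂ (Tabloid μ N) :=
  (permBasis _ _).constr ℂ fun t => permBasis _ _ (t.lift hN x)

/-- The linear retraction of `liftMap` that kills the tabloids which are not lifts. -/
noncomputable def unliftMap : MonoidAlgebra ℂ (Tabloid μ N) →ₗ[ℂ]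
    MonoidAlgebra ℂ (Tabloid μ.deleteFirstRow K) :=
  (MonoidAlgebra.coeffLinearEquiv ℂ).symm.toLinearMap ∘ₗ
    Finsupp.lcomapDomain _ (Tabloid.lift_injective hN x) ∘ₗ
      (MonoidAlgebra.coeffLinearEquiv ℂ).toLinearMap

theorem liftMap_permBasis (t : Tabloid μ.deleteFirstRow K) :
    liftMap hN x (permBasis _ _ t) = permBasis _ _ (t.lift hN x) :=
  Module.Basis.constr_basis _ _ _ _

theorem coeff_unliftMap (v : MonoidAlgebra ℂ (Tabloid μ N)) (t : Tabloid μ.deleteFirstRow K) :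
    (unliftMap hN x v).coeff t = v.coeff (t.lift hN x) := rfl

theorem permModule_ext {v w : MonoidAlgebra ℂ (Tabloid μ α)} (h : ∀ t, v.coeff t = w.coeff t) :
    v = w :=
  (permBasis μ α).ext_elem h

theorem unliftMap_permBasis_lift (t : Tabloid μ.deleteFirstRow K) :
    unliftMap hN x (permBasis _ _ (t.lift hN x)) = permBasis _ _ t := by
  refine permModule_ext fun s => ?_
  rw [coeff_unliftMap]
  by_cases h : t = s
  · subst h
    rw [permBasis_coeff_self, permBasis_coeff_self]
  · rw [permBasis_coeff_of_ne h, permBasis_coeff_of_ne fun h' => h (Tabloid.lift_injective hN x h')]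

theorem unliftMap_permBasis_eq_zero {s : Tabloid μ N} {i : K} (hi : x i ∉ s.lower) :
    unliftMap hN x (permBasis _ _ s) = 0 := by
  refine permModule_ext fun t => ?_
  rw [coeff_unliftMap, permBasis_coeff_of_ne]
  · rfl
  · rintro rfl
    exact hi ((Tabloid.mem_lower_lift hN x).2 ⟨i, rfl⟩)

theorem liftMap_smul {g : Perm N} {π : Perm K} (hg : ∀ i, g (x i) = x (π i))
    (u : MonoidAlgebra ℂ (Tabloid μ.deleteFirstRow K)) :
    permModule μ N g (liftMap hN x u) = liftMap hN x (permModule _ K π u) := by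
  have : permModule μ N g ∘ₗ liftMap hN x = liftMap hN x ∘ₗ permModule _ K π := by
    refine (permBasis _ _).ext fun t => ?_
    simp only [LinearMap.comp_apply, liftMap_permBasis, permModule_permBasis]
    rw [Tabloid.smul_lift hN x hg]
  exact LinearMap.congr_fun this u

end

/-! ### Irreducibility of Specht modules -/

section

variable {μ : YoungDiagram} {α : Type} [Fintype α] [DecidableEq α]

theorem mem_columnGroup {T : α ≃ μ.cells} {q : Perm α} :
    q ∈ columnGroup T ↔ ∀ a, (T (q a)).1.2 = (T a).1.2 := by
  simp [columnGroup]

theorem one_mem_columnGroup (T : α ≃ μ.cells) : 1 ∈ columnGroup T :=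
  mem_columnGroup.2 fun _ => rfl

theorem mul_mem_columnGroup {T : α ≃ μ.cells} {p q : Perm α} (hp : p ∈ columnGroup T)
    (hq : q ∈ columnGroup T) : p * q ∈ columnGroup T :=
  mem_columnGroup.2 fun a =>
    (mem_columnGroup.1 hp (q a)).trans (mem_columnGroup.1 hq a)

theorem inv_mem_columnGroup {T : α ≃ μ.cells} {p : Perm α} (hp : p ∈ columnGroup T) :
    p⁻¹ ∈ columnGroup T :=
  mem_columnGroup.2 fun a => by
    have := mem_columnGroup.1 hp (p⁻¹ a)
    rw [← Perm.mul_apply, mul_inv_cancel] at this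
    exact this.symm

theorem swap_mem_columnGroup {T : α ≃ μ.cells} {a b : α} (h : (T a).1.2 = (T b).1.2) :
    swap a b ∈ columnGroup T :=
  mem_columnGroup.2 fun c => by
    rw [swap_apply_def]
    split_ifs with h1 h2
    · rw [h1, h]
    · rw [h2, h]
    · rfl

theorem eq_one_of_mem_columnGroup {T : α ≃ μ.cells} {q : Perm α} (hq : q ∈ columnGroup T)
    (h : q • tabloid T = tabloid T) : q = 1 := by
  ext a
  have h1 : (T (q.symm (q a))).1.1 = (T (q a)).1.1 :=
    congrArg (fun t : Tabloid μ α => t.1 (q a)) h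
  rw [symm_apply_apply] at h1
  exact T.injective (Subtype.ext (Prod.ext h1.symm (mem_columnGroup.1 hq a)))

/-- The signed column sum of a numbering `T`, acting on `M^μ`. -/
noncomputable def columnSum (T : α ≃ μ.cells) :
    MonoidAlgebra ℂ (Tabloid μ α) →ₗ[ℂ] MonoidAlgebra ℂ (Tabloid μ α) :=
  ∑ q ∈ columnGroup T, ((Perm.sign q : ℤ) : ℂ) • permModule μ α q

theorem columnSum_apply (T : α ≃ μ.cells) (v : MonoidAlgebra ℂ (Tabloid μ α)) :
    columnSum T v = ∑ q ∈ columnGroup T, ((Perm.sign q : ℤ) : ℂ) • permModule μ α q v := by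
  simp only [columnSum, LinearMap.sum_apply, LinearMap.smul_apply]

theorem columnSum_tabloid (T : α ≃ μ.cells) :
    columnSum T (permBasis μ α (tabloid T)) = polytabloid T := by
  rw [columnSum_apply, polytabloid_eq]
  exact Finset.sum_congr rfl fun q _ => by rw [permModule_permBasis]

theorem columnSum_smul {T : α ≃ μ.cells} {p : Perm α} (hp : p ∈ columnGroup T)
    (v : MonoidAlgebra ℂ (Tabloid μ α)) :
    columnSum T (permModule μ α p v) = ((Perm.sign p : ℤ) : ℂ) • columnSum T v := by
  simp only [columnSum_apply, Finset.smul_sum, smul_smul]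
  refine Finset.sum_equiv (Equiv.mulRight p) (fun q => ?_) fun q _ => ?_
  · rw [Equiv.coe_mulRight]
    refine ⟨fun h => mul_mem_columnGroup h hp, fun h => ?_⟩
    simpa using mul_mem_columnGroup h (inv_mem_columnGroup hp)
  · simp only [Equiv.coe_mulRight, map_mul, Units.val_mul, Int.cast_mul, Module.End.mul_apply]
    congr 1
    rw [mul_comm, mul_assoc, sign_mul_self_cast, mul_one]

theorem permModule_polytabloid_of_mem {T : α ≃ μ.cells} {p : Perm α} (hp : p ∈ columnGroup T) :
    permModule μ α p (polytabloid T) = ((Perm.sign p : ℤ) : ℂ) • polytabloid T := by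
  simp only [polytabloid_eq, Finset.smul_sum, smul_smul, map_sum, map_smul, permModule_permBasis]
  refine Finset.sum_equiv (Equiv.mulLeft p) (fun q => ?_) fun q _ => ?_
  · rw [Equiv.coe_mulLeft]
    refine ⟨fun h => mul_mem_columnGroup hp h, fun h => ?_⟩
    simpa using mul_mem_columnGroup (inv_mem_columnGroup hp) h
  · simp only [Equiv.coe_mulLeft, map_mul, Units.val_mul, Int.cast_mul]
    rw [← mul_assoc, sign_mul_self_cast, one_mul]

/-- If the entries in each column of `T` lie in distinct rows of the tabloid `t`, then `t` is
obtained from the tabloid of `T` by a column permutation.  Since `t` and `T` have equally many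
entries in the first `r` rows, and every column of `T` has at most `min r (colLen)` entries in the
first `r` rows of `t`, equality holds in each column. -/
theorem exists_mem_columnGroup_smul_tabloid_eq (T : α ≃ μ.cells) (t : Tabloid μ α)
    (h : ∀ a b, (T a).1.2 = (T b).1.2 → t.1 a = t.1 b → a = b) :
    ∃ q ∈ columnGroup T, q • tabloid T = t := by
  have hlt : ∀ a, t.1 a < μ.colLen (T a).1.2 := by
    intro a₀
    -- the counting argument, with `r` the length of the column of `a₀`
    set r := μ.colLen (T a₀).1.2 with hr
    set A : ℕ → Finset α := fun c => Finset.univ.filter fun a => t.1 a < r ∧ (T a).1.2 = c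
    set B : ℕ → Finset α := fun c => Finset.univ.filter fun a => (T a).1.1 < r ∧ (T a).1.2 = c
    have hrow : ∀ a, (T a).1.1 < μ.colLen (T a).1.2 := fun a =>
      mem_iff_lt_colLen.1 ((mem_cells _).1 (T a).2)
    have hle : ∀ c, (A c).card ≤ (B c).card := by
      intro c
      rcases le_total (μ.colLen c) r with hc | hc
      · refine Finset.card_le_card fun a ha => ?_
        simp only [A, B, Finset.mem_filter, Finset.mem_univ, true_and] at ha ⊢
        exact ⟨by have := hrow a; rw [ha.2] at this; omega, ha.2⟩
      · have hA : (A c).card ≤ (Finset.range r).card := by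
          refine Finset.card_le_card_of_injOn t.1 (fun a ha => ?_) fun a ha b hb hab => ?_
          · simp only [A, Finset.coe_filter, Finset.mem_univ, true_and, Set.mem_ofPred_eq] at ha
            simpa using ha.1
          · simp only [A, Finset.coe_filter, Finset.mem_univ, true_and, Set.mem_ofPred_eq] at ha hb
            exact h a b (ha.2.trans hb.2.symm) hab
        have hB : (Finset.range r).card ≤ (B c).card := by
          refine Finset.card_le_card_of_surjOn (fun a => (T a).1.1) fun i hi => ?_
          have hi' : i < r := by simpa using hi
          have hmem : (i, c) ∈ μ.cells := (mem_cells _).2 (mem_iff_lt_colLen.2 (by omega))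
          refine ⟨T.symm ⟨(i, c), hmem⟩, ?_, ?_⟩
          · simp [B, hi']
          · simp
        omega
    have hcard : ∀ f : α → ℕ, (∀ i, (Finset.univ.filter fun a => f a = i).card = μ.rowLen i) →
        ∑ c ∈ Finset.univ.image (fun a => (T a).1.2),
          (Finset.univ.filter fun a => f a < r ∧ (T a).1.2 = c).card =
            ∑ i ∈ Finset.range r, μ.rowLen i := by
      intro f hf
      have h1 := Finset.card_eq_sum_card_fiberwise (f := fun a => (T a).1.2)
        (s := Finset.univ.filter fun a => f a < r) (t := Finset.univ.image fun a => (T a).1.2)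
        fun a _ => by simp
      have h2 := Finset.card_eq_sum_card_fiberwise (f := f)
        (s := Finset.univ.filter fun a => f a < r) (t := Finset.range r)
        fun a ha => by simpa using ha
      simp only [Finset.filter_filter] at h1 h2
      rw [← h1, h2]
      refine Finset.sum_congr rfl fun i hi => ?_
      rw [← hf i]
      congr 1
      ext a
      have := Finset.mem_range.1 hi
      simp only [Finset.mem_filter, Finset.mem_univ, true_and]
      constructor
      · exact fun h => h.2
      · exact fun h => ⟨by omega, h⟩
    have heq := (hcard t.1 t.card_fiber).trans (hcard _ (tabloid T).card_fiber).symm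
    have hAB : ∀ c ∈ Finset.univ.image (fun a => (T a).1.2), (A c).card = (B c).card :=
      (Finset.sum_eq_sum_iff_of_le fun c _ => hle c).1 heq
    have hc := hAB _ (Finset.mem_image_of_mem _ (Finset.mem_univ a₀))
    have hsub : A (T a₀).1.2 ⊆ B (T a₀).1.2 := by
      intro a ha
      simp only [A, B, Finset.mem_filter, Finset.mem_univ, true_and] at ha ⊢
      refine ⟨?_, ha.2⟩
      have := hrow a
      rwa [ha.2] at this
    have hmem : a₀ ∈ A (T a₀).1.2 := by
      rw [Finset.eq_of_subset_of_card_le hsub hc.ge]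
      simp only [B, Finset.mem_filter, Finset.mem_univ, true_and, and_true]
      exact hrow a₀
    exact (Finset.mem_filter.1 hmem).2.1
  set p : α → α := fun a =>
    T.symm ⟨(t.1 a, (T a).1.2), (mem_cells _).2 (mem_iff_lt_colLen.2 (hlt a))⟩
  have hp : ∀ a, (T (p a)).1 = (t.1 a, (T a).1.2) := fun a => by simp [p]
  have hinj : Function.Injective p := by
    intro a b hab
    have h1 := hp a
    rw [hab, hp b, Prod.mk.injEq] at h1
    exact h a b h1.2.symm h1.1.symm
  set P : Perm α := Equiv.ofBijective p (Finite.injective_iff_bijective.1 hinj)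
  have hP : P ∈ columnGroup T := mem_columnGroup.2 fun a => by
    have := congrArg Prod.snd (hp a)
    exact this
  refine ⟨P⁻¹, inv_mem_columnGroup hP, ?_⟩
  rw [inv_smul_eq_iff]
  refine Tabloid.ext fun a => ?_
  rw [Tabloid.smul_val]
  obtain ⟨b, rfl⟩ := P.surjective a
  rw [symm_apply_apply]
  exact congrArg Prod.fst (hp b)

/-- The column sum of `T` maps `M^μ` into the line of `e_T`: a tabloid with two entries of one
column of `T` in the same row is killed, and every other tabloid is in the orbit of the tabloid of
`T` under the column group. -/
theorem exists_columnSum_eq_smul (T : α ≃ μ.cells) (v : MonoidAlgebra ℂ (Tabloid μ α)) :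
    ∃ c : ℂ, columnSum T v = c • polytabloid T := by
  have hb : ∀ t, ∃ c : ℂ, columnSum T (permBasis μ α t) = c • polytabloid T := by
    intro t
    by_cases h : ∀ a b, (T a).1.2 = (T b).1.2 → t.1 a = t.1 b → a = b
    · obtain ⟨q, hq, rfl⟩ := exists_mem_columnGroup_smul_tabloid_eq T t h
      refine ⟨((Perm.sign q : ℤ) : ℂ), ?_⟩
      rw [← permModule_permBasis, columnSum_smul hq, columnSum_tabloid]
    · push Not at h
      obtain ⟨a, b, hcol, hrow, hab⟩ := h
      refine ⟨0, ?_⟩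
      have h1 : swap a b • t = t := by
        refine Tabloid.ext fun c => ?_
        rw [Tabloid.smul_val, symm_swap, swap_apply_def]
        split_ifs with h1 h2
        · rw [h1, hrow]
        · rw [h2, hrow]
        · rfl
      have h2 := columnSum_smul (swap_mem_columnGroup hcol) (permBasis μ α t)
      rw [permModule_permBasis, h1, Perm.sign_swap hab] at h2
      simp only [Units.val_neg, Units.val_one, Int.cast_neg, Int.cast_one, neg_smul,
        one_smul] at h2
      rw [zero_smul]
      have h3 : (2 : ℂ) • columnSum T (permBasis μ α t) = 0 := by
        rw [two_smul]; nth_rewrite 1 [h2]; simp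
      exact (smul_eq_zero.1 h3).resolve_left two_ne_zero
  choose c hc using hb
  refine ⟨∑ t, (permBasis μ α).repr v t * c t, ?_⟩
  conv_lhs => rw [← (permBasis μ α).sum_repr v]
  simp only [map_sum, map_smul, hc, smul_smul, Finset.sum_smul]

/-- Pairing a vector with `e_T` gives a coefficient of its column sum, since the column sum is
self-adjoint for the bilinear form with the tabloids as orthonormal basis. -/
theorem sum_polytabloid_coeff_mul (T : α ≃ μ.cells) (v : MonoidAlgebra ℂ (Tabloid μ α)) :
    ∑ t, (polytabloid T).coeff t * v.coeff t = (columnSum T v).coeff (tabloid T) := by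
  rw [columnSum_apply, coeff_sum_smul]
  simp only [polytabloid_eq, coeff_sum_smul, Finset.sum_mul]
  rw [Finset.sum_comm]
  refine Finset.sum_equiv (Equiv.inv _) (fun q => ?_) fun q _ => ?_
  · rw [Equiv.inv_apply]
    exact ⟨inv_mem_columnGroup, fun h => by simpa using inv_mem_columnGroup h⟩
  · rw [Finset.sum_eq_single (q • tabloid T)]
    · rw [permBasis_coeff_self, Representation.coeff_ofMulAction]
      simp
    · intro t _ ht
      rw [permBasis_coeff_of_ne ht.symm]
      simp
    · simp

theorem polytabloid_mem (T : α ≃ μ.cells) : polytabloid T ∈ (spechtSub μ α).toSubmodule :=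
  Submodule.subset_span ⟨T, rfl⟩

theorem polytabloid_coeff_tabloid (T : α ≃ μ.cells) :
    (polytabloid T).coeff (tabloid T) = 1 := by
  rw [polytabloid_eq, coeff_sum_smul, Finset.sum_eq_single 1]
  · rw [one_smul, permBasis_coeff_self]
    simp
  · intro q hq h1
    rw [permBasis_coeff_of_ne fun h => h1 (eq_one_of_mem_columnGroup hq h), mul_zero]
  · exact fun h => absurd (one_mem_columnGroup T) h

theorem polytabloid_ne_zero (T : α ≃ μ.cells) : polytabloid T ≠ 0 := by
  intro h
  have := polytabloid_coeff_tabloid T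
  rw [h] at this
  exact zero_ne_one this

/-- A vector of the Specht module that is killed by all column sums is orthogonal to all
polytabloids, hence to itself. -/
theorem eq_zero_of_columnSum_eq_zero {v : MonoidAlgebra ℂ (Tabloid μ α)}
    (hv : v ∈ (spechtSub μ α).toSubmodule) (h : ∀ T : α ≃ μ.cells, columnSum T v = 0) : v = 0 := by
  have key : ∀ w ∈ (spechtSub μ α).toSubmodule,
      ∑ t, (starRingEnd ℂ) (w.coeff t) * v.coeff t = 0 := by
    intro w hw
    refine Submodule.span_induction (p := fun w _ =>
      ∑ t, (starRingEnd ℂ) (w.coeff t) * v.coeff t = 0) ?_ ?_ ?_ ?_ hw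
    · rintro _ ⟨T, rfl⟩
      have hreal : ∀ t, (starRingEnd ℂ) ((polytabloid T).coeff t) = (polytabloid T).coeff t := by
        intro t
        rw [polytabloid_eq, coeff_sum_smul, map_sum]
        refine Finset.sum_congr rfl fun q _ => ?_
        rw [map_mul, map_intCast]
        congr 1
        by_cases hq : q • tabloid T = t
        · rw [hq, permBasis_coeff_self, map_one]
        · rw [permBasis_coeff_of_ne hq, map_zero]
      simp only [hreal]
      rw [sum_polytabloid_coeff_mul, h T]
      rfl
    · simp
    · intro x y _ _ hx hy
      simp only [MonoidAlgebra.coeff_add, Finsupp.add_apply, map_add, add_mul,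
        Finset.sum_add_distrib, hx, hy, add_zero]
    · intro a x _ hx
      simp only [MonoidAlgebra.coeff_smul, Finsupp.smul_apply, smul_eq_mul, map_mul, mul_assoc,
        ← Finset.mul_sum, hx, mul_zero]
  have h0 := key v hv
  simp only [← Complex.normSq_eq_conj_mul_self] at h0
  rw [← Complex.ofReal_sum, Complex.ofReal_eq_zero,
    Finset.sum_eq_zero_iff_of_nonneg fun t _ => Complex.normSq_nonneg _] at h0
  exact permModule_ext fun t => Complex.normSq_eq_zero.1 (h0 t (Finset.mem_univ t))

/-- The Specht module is irreducible: it is contained in every invariant subspace that contains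
one of its nonzero vectors. -/
theorem spechtSub_le_of_mem {N : Submodule ℂ (MonoidAlgebra ℂ (Tabloid μ α))}
    (hN : ∀ g, ∀ v ∈ N, permModule μ α g v ∈ N) {v : MonoidAlgebra ℂ (Tabloid μ α)}
    (hvS : v ∈ (spechtSub μ α).toSubmodule) (hvN : v ∈ N) (hv : v ≠ 0) :
    (spechtSub μ α).toSubmodule ≤ N := by
  obtain ⟨T, hT⟩ : ∃ T : α ≃ μ.cells, columnSum T v ≠ 0 := by
    by_contra! h
    exact hv (eq_zero_of_columnSum_eq_zero hvS h)
  obtain ⟨c, hc⟩ := exists_columnSum_eq_smul T v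
  have hmem : columnSum T v ∈ N := by
    rw [columnSum_apply]
    exact N.sum_mem fun q _ => N.smul_mem _ (hN q v hvN)
  rw [hc] at hmem hT
  have hTN : polytabloid T ∈ N :=
    (N.smul_mem_iff fun h => hT (by rw [h, zero_smul])).1 hmem
  refine Submodule.span_le.2 ?_
  rintro _ ⟨T', rfl⟩
  have h1 : permNumbering (T.trans T'.symm) T = T' := by
    ext a
    · simp [permNumbering, Perm.inv_def]
    · simp [permNumbering, Perm.inv_def]
  have h2 := hN (T.trans T'.symm) _ hTN
  rwa [permModule_polytabloid, h1] at h2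

end

/-! ### The pair-alternating part of a Specht module -/

section

variable {μ : YoungDiagram} {K N : Type} [Fintype K] [DecidableEq K] [Fintype N] [DecidableEq N]
  (hN : μ.card = Fintype.card N)

/-- Deleting the first rows of the tabloids of `e_T` leaves a polytabloid if the entries of `T`
below its first row are the `x i`: the column permutations that keep this set of entries fix the
first row pointwise, and are the column permutations of the numbering without its first row. -/
theorem unliftMap_polytabloid (x : K ↪ N) (T : N ≃ μ.cells) (t : Tabloid μ.deleteFirstRow K)
    (h : tabloid T = t.lift hN x) :
    ∃ S : K ≃ μ.deleteFirstRow.cells, unliftMap hN x (polytabloid T) = polytabloid S := by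
  have hrow : ∀ i, (T (x i)).1.1 = t.1 i + 1 := fun i => by
    rw [← Tabloid.lift_apply hN x, ← h]; rfl
  have hrow' : ∀ a, a ∉ Set.range x → (T a).1.1 = 0 := fun a ha => by
    rw [← Tabloid.lift_apply_of_notMem hN x t ha, ← h]; rfl
  set f : K → μ.deleteFirstRow.cells := fun i => ⟨(t.1 i, (T (x i)).1.2), by
    rw [mem_cells, mem_deleteFirstRow, ← hrow, ← mem_cells]
    exact (T (x i)).2⟩ with hf
  have hfinj : Function.Injective f := by
    intro i j hij
    have h1 := congrArg Subtype.val hij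
    simp only [hf, Prod.mk.injEq] at h1
    refine x.injective (T.injective (Subtype.ext (Prod.ext ?_ h1.2)))
    rw [hrow, hrow, h1.1]
  have hfbij : Function.Bijective f := by
    rw [Fintype.bijective_iff_injective_and_card]
    exact ⟨hfinj, by rw [t.card_eq, Fintype.card_coe]⟩
  set S : K ≃ μ.deleteFirstRow.cells := Equiv.ofBijective f hfbij
  have hScol : ∀ i, (S i).1.2 = (T (x i)).1.2 := fun _ => rfl
  have hSt : tabloid S = t := Tabloid.ext fun _ => rfl
  refine ⟨S, ?_⟩
  rw [polytabloid_eq, polytabloid_eq, map_sum]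
  symm
  have hfix : ∀ (q : Perm K) (i : K), q.viaEmbedding x (x i) = x (q i) :=
    fun q i => Perm.viaEmbedding_apply _ _ _
  refine Finset.sum_of_injOn (fun q => q.viaEmbedding x)
    ((Perm.viaEmbeddingHom_injective x).injOn) ?_ ?_ ?_
  · intro q hq
    rw [Finset.mem_coe, mem_columnGroup] at hq ⊢
    intro a
    by_cases ha : a ∈ Set.range x
    · obtain ⟨i, rfl⟩ := ha
      rw [hfix, ← hScol, ← hScol, hq]
    · rw [Perm.viaEmbedding_apply_of_notMem _ _ _ ha]
  · intro q hq hqS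
    rw [map_smul]
    by_contra hne
    obtain ⟨s, hs⟩ : ∃ s, Tabloid.lift hN x s = q • tabloid T := by
      by_contra! hs
      refine hne ?_
      rw [smul_eq_zero]
      right
      refine permModule_ext fun s => ?_
      rw [coeff_unliftMap, permBasis_coeff_of_ne (hs s).symm]
      rfl
    have hfix' : ∀ a, a ∉ Set.range x → q a = a := by
      intro a ha
      have h1 : (Tabloid.lift hN x s).1 (q a) = 0 := by
        rw [hs, Tabloid.smul_val, symm_apply_apply]
        exact hrow' a ha
      have h2 : q a ∉ Set.range x := by
        rintro ⟨i, hi⟩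
        rw [← hi, Tabloid.lift_apply] at h1
        exact Nat.succ_ne_zero _ h1
      refine T.injective (Subtype.ext (Prod.ext ?_ (mem_columnGroup.1 hq a)))
      rw [hrow' _ h2, hrow' _ ha]
    have hran : ∀ i, ∃ j, x j = q (x i) := by
      intro i
      by_contra hi
      have := q.injective (hfix' (q (x i)) hi)
      exact hi ⟨i, this.symm⟩
    choose p hp using hran
    have hpinj : Function.Injective p := fun i j hij => by
      refine x.injective (q.injective ?_)
      rw [← hp, ← hp, hij]
    set P : Perm K := Equiv.ofBijective p (Finite.injective_iff_bijective.1 hpinj)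
    refine hqS ⟨P, ?_, ?_⟩
    · rw [Finset.mem_coe, mem_columnGroup]
      intro i
      rw [hScol, hScol, ← mem_columnGroup.1 hq (x i), ← hp]
      rfl
    · ext a
      by_cases ha : a ∈ Set.range x
      · obtain ⟨i, rfl⟩ := ha
        rw [hfix, ← hp]
        rfl
      · rw [Perm.viaEmbedding_apply_of_notMem _ _ _ ha, hfix' _ ha]
  · intro q _
    have hsign : Perm.sign (q.viaEmbedding x) = Perm.sign q := by
      simp only [Perm.viaEmbedding, Perm.sign_extendDomain]
    rw [hsign, h, Tabloid.smul_lift hN x (hfix q), (unliftMap hN x).map_smul,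
      unliftMap_permBasis_lift, hSt]

/-- Deleting the first row maps the Specht module of `μ` into the Specht module of `μ` without its
first row. -/
theorem unliftMap_mem_spechtSub (x : K ↪ N) {v : MonoidAlgebra ℂ (Tabloid μ N)}
    (hv : v ∈ (spechtSub μ N).toSubmodule) :
    unliftMap hN x v ∈ (spechtSub μ.deleteFirstRow K).toSubmodule := by
  have hle : (spechtSub μ N).toSubmodule ≤
      (spechtSub μ.deleteFirstRow K).toSubmodule.comap (unliftMap hN x) := by
    refine Submodule.span_le.2 ?_
    rintro _ ⟨T, rfl⟩
    change unliftMap hN x (polytabloid T) ∈ (spechtSub μ.deleteFirstRow K).toSubmodule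
    by_cases h0 : ∀ t, (polytabloid T).coeff (Tabloid.lift hN x t) = 0
    · have : unliftMap hN x (polytabloid T) = 0 := permModule_ext fun t => h0 t
      rw [this]
      exact Submodule.zero_mem _
    · push Not at h0
      obtain ⟨t, ht⟩ := h0
      rw [polytabloid_eq, coeff_sum_smul] at ht
      obtain ⟨q, hq, hqt⟩ := Finset.exists_ne_zero_of_sum_ne_zero ht
      have hqT : tabloid (permNumbering q T) = t.lift hN x := by
        by_contra hne
        rw [← smul_tabloid] at hne
        rw [permBasis_coeff_of_ne hne, mul_zero] at hqt
        exact hqt rfl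
      obtain ⟨S, hS⟩ := unliftMap_polytabloid hN x _ t hqT
      rw [← permModule_polytabloid, permModule_polytabloid_of_mem hq, map_smul] at hS
      have h1 := Submodule.smul_mem _ ((Perm.sign q : ℤ) : ℂ) (polytabloid_mem S)
      rwa [← hS, smul_smul, sign_mul_self_cast, one_smul] at h1
  exact hle hv

variable (e : K × ℤˣ ↪ N)

/-- The antisymmetrized lift from `M^σ` to `M^μ`, where `σ` is `μ` without its first row: the
entries of a tabloid of shape `σ` become the first members of the pairs. -/
noncomputable def altLift : MonoidAlgebra ℂ (Tabloid μ.deleteFirstRow K) →ₗ[ℂ]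
    MonoidAlgebra ℂ (Tabloid μ N) :=
  pairAlt (permModule μ N) e ∘ₗ liftMap hN (pairFst e)

theorem altLift_apply (u : MonoidAlgebra ℂ (Tabloid μ.deleteFirstRow K)) :
    altLift hN e u = pairAlt (permModule μ N) e (liftMap hN (pairFst e) u) := rfl

theorem altLift_permBasis (t : Tabloid μ.deleteFirstRow K) :
    altLift hN e (permBasis _ _ t) = ∑ ε : K → ℤˣ, ((Perm.sign (pairSwap e ε) : ℤ) : ℂ) •
      permBasis _ _ (pairSwap e ε • t.lift hN (pairFst e)) := by
  rw [altLift_apply, liftMap_permBasis, pairAlt_apply]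
  simp only [permModule_permBasis]

theorem unliftMap_altLift (u : MonoidAlgebra ℂ (Tabloid μ.deleteFirstRow K)) :
    unliftMap hN (pairFst e) (altLift hN e u) = u := by
  have : unliftMap hN (pairFst e) ∘ₗ altLift hN e = LinearMap.id := by
    refine (permBasis _ _).ext fun t => ?_
    rw [LinearMap.comp_apply, altLift_permBasis, map_sum, Finset.sum_eq_single 1]
    · simp [unliftMap_permBasis_lift]
    · intro ε _ hε
      obtain ⟨i, hi⟩ := Function.ne_iff.1 hε
      rw [map_smul, unliftMap_permBasis_eq_zero (i := i), smul_zero]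
      intro hmem
      obtain ⟨b, hb⟩ := (pairSwap e ε).surjective (pairFst e i)
      rw [← hb, Tabloid.smul_mem_lower, Tabloid.mem_lower_lift] at hmem
      obtain ⟨j, rfl⟩ := hmem
      rw [pairFst_apply, pairSwap_apply, pairFst_apply, mul_one] at hb
      have h1 := e.injective hb
      simp only [Prod.mk.injEq] at h1
      rw [h1.1] at h1
      exact hi h1.2
    · simp
  exact LinearMap.congr_fun this u

theorem altLift_injective : Function.Injective (altLift (μ := μ) hN e) :=
  Function.LeftInverse.injective (unliftMap_altLift hN e)

/-- If a permutation moves no member of a pair to the first member of the `i`-th pair, then this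
letter is in the first row of all tabloids that occur in the permuted antisymmetrized lift, and
`unliftMap` kills them. -/
theorem unliftMap_permModule_altLift_eq_zero {g : Perm N} {i : K}
    (hg : ∀ p, g (e p) ≠ e (i, 1)) (u : MonoidAlgebra ℂ (Tabloid μ.deleteFirstRow K)) :
    unliftMap hN (pairFst e) (permModule μ N g (altLift hN e u)) = 0 := by
  have : unliftMap hN (pairFst e) ∘ₗ permModule μ N g ∘ₗ altLift hN e = 0 := by
    refine (permBasis _ _).ext fun t => ?_
    rw [LinearMap.comp_apply, LinearMap.comp_apply, altLift_permBasis, map_sum, map_sum]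
    refine Finset.sum_eq_zero fun ε _ => ?_
    rw [map_smul, map_smul, permModule_permBasis, unliftMap_permBasis_eq_zero (i := i), smul_zero]
    intro hmem
    obtain ⟨b, hb⟩ := g.surjective (pairFst e i)
    obtain ⟨c, rfl⟩ := (pairSwap e ε).surjective b
    rw [← hb, Tabloid.smul_mem_lower, Tabloid.smul_mem_lower, Tabloid.mem_lower_lift] at hmem
    obtain ⟨j, rfl⟩ := hmem
    rw [pairFst_apply, pairSwap_apply] at hb
    exact hg _ hb
  exact LinearMap.congr_fun this u

/-- Only the action of a permutation on the pairs matters for antisymmetrized lifts. -/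
theorem permModule_altLift_congr {g g' : Perm N} (h : ∀ p, g (e p) = g' (e p))
    (u : MonoidAlgebra ℂ (Tabloid μ.deleteFirstRow K)) :
    permModule μ N g (altLift hN e u) = permModule μ N g' (altLift hN e u) := by
  have : permModule μ N g ∘ₗ altLift hN e = permModule μ N g' ∘ₗ altLift hN e := by
    refine (permBasis _ _).ext fun t => ?_
    simp only [LinearMap.comp_apply, altLift_permBasis, map_sum, map_smul, permModule_permBasis]
    refine Finset.sum_congr rfl fun ε _ => ?_
    congr 2
    rw [smul_smul, smul_smul]
    refine Tabloid.smul_congr fun a ha => ?_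
    obtain ⟨i, rfl⟩ := (Tabloid.mem_lower_lift _ _).1 ha
    rw [Perm.mul_apply, Perm.mul_apply, pairFst_apply, pairSwap_apply, h]
  exact LinearMap.congr_fun this u

theorem permModule_pairPerm_altLift (π : Perm K)
    (u : MonoidAlgebra ℂ (Tabloid μ.deleteFirstRow K)) :
    permModule μ N (pairPerm e π) (altLift hN e u) = altLift hN e (permModule _ K π u) := by
  rw [altLift_apply, altLift_apply, ← pairAlt_pairPerm, liftMap_smul hN (pairFst e) (π := π)]
  exact fun i => pairPerm_apply e π i 1

/-- The pair-alternating vectors of `M^μ` are the antisymmetrized lifts. -/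
theorem exists_pairAlt_eq_altLift (hK : Fintype.card K = μ.deleteFirstRow.card)
    (v : MonoidAlgebra ℂ (Tabloid μ N)) :
    ∃ u, pairAlt (permModule μ N) e v = altLift hN e u := by
  suffices h : ⊤ ≤ (LinearMap.range (altLift hN e)).comap (pairAlt (permModule μ N) e) by
    obtain ⟨u, hu⟩ := h (Submodule.mem_top (x := v))
    exact ⟨u, hu.symm⟩
  rw [← (permBasis μ N).span_eq]
  refine Submodule.span_le.2 ?_
  rintro _ ⟨t, rfl⟩
  rcases pairAlt_eq_zero_or (permModule μ N) e (permBasis μ N t) t.lower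
    (by rw [t.card_lower, hK]) (fun g hg => by
      rw [permModule_permBasis, Tabloid.smul_eq_self hg]) with h | ⟨ε, h, hε⟩
  · exact ⟨0, by rw [map_zero, h]⟩
  · obtain ⟨s, hs⟩ := Tabloid.exists_lift_eq hN (pairFst e) hK (pairSwap e ε • t) fun a ha => by
      obtain ⟨b, rfl⟩ := (pairSwap e ε).surjective a
      rw [Tabloid.smul_mem_lower] at ha
      obtain ⟨i, hi⟩ := hε.1 b ha
      exact ⟨i, hi.symm⟩
    refine ⟨((Perm.sign (pairSwap e ε) : ℤ) : ℂ) • permBasis _ _ s, ?_⟩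
    rw [h, map_smul, altLift_apply, liftMap_permBasis, hs, permModule_permBasis]

theorem altLift_unliftMap_pairAlt (hK : Fintype.card K = μ.deleteFirstRow.card)
    (v : MonoidAlgebra ℂ (Tabloid μ N)) :
    altLift hN e (unliftMap hN (pairFst e) (pairAlt (permModule μ N) e v)) =
      pairAlt (permModule μ N) e v := by
  obtain ⟨u, hu⟩ := exists_pairAlt_eq_altLift hN e hK v
  rw [hu, unliftMap_altLift]

open scoped Classical in
/-- Take a numbering `T` whose entries below the first row are the first members of the pairs, and
for which the second member of the pair of a second row entry is just above it.  Then the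
coefficient of the tabloid of `T` in the antisymmetrized polytabloid of `T` is a sum of terms `1`,
because `pairSwap e ε * q` can only fix this tabloid if `pairSwap e ε` is a column permutation. -/
theorem exists_pairAlt_polytabloid_ne_zero (hN : μ.card = Fintype.card N) (e : K × ℤˣ ↪ N)
    (hK : Fintype.card K = μ.deleteFirstRow.card) :
    ∃ T : N ≃ μ.cells, pairAlt (permModule μ N) e (polytabloid T) ≠ 0 := by
  obtain ⟨S⟩ : Nonempty (K ≃ μ.deleteFirstRow.cells) :=
    ⟨Fintype.equivOfCardEq (by rw [hK, Fintype.card_coe])⟩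
  have hSmem : ∀ i, ((S i).1.1 + 1, (S i).1.2) ∈ μ := fun i => by
    rw [← mem_deleteFirstRow, ← mem_cells]
    exact (S i).2
  set f : K × ℤˣ → ℕ × ℕ := fun p => (if p.2 = 1 then (S p.1).1.1 + 1 else 0, (S p.1).1.2) with hf
  set s : Finset (K × ℤˣ) := Finset.univ.filter fun p => p.2 = 1 ∨ (S p.1).1.1 = 0 with hs
  have hneg : ((-1 : ℤˣ) = 1) = False := by decide
  obtain ⟨T, hT⟩ : ∃ T : N ≃ μ.cells, ∀ a ∈ s.map e, (T a).1 = Function.extend e f 0 a := by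
    refine Finset.exists_equiv_extend_of_card_eq hN.symm ?_ ?_
    · intro c hc
      obtain ⟨a, ha, rfl⟩ := Finset.mem_image.1 hc
      obtain ⟨p, -, rfl⟩ := Finset.mem_map.1 ha
      rw [e.injective.extend_apply, mem_cells]
      have hle : (f p).1 ≤ (S p.1).1.1 + 1 := by
        simp only [hf]
        split_ifs <;> omega
      exact μ.up_left_mem hle le_rfl (hSmem p.1)
    · intro a ha b hb hab
      obtain ⟨⟨i, u⟩, hp, rfl⟩ := Finset.mem_map.1 (Finset.mem_coe.1 ha)
      obtain ⟨⟨j, w⟩, hq, rfl⟩ := Finset.mem_map.1 (Finset.mem_coe.1 hb)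
      rw [e.injective.extend_apply, e.injective.extend_apply] at hab
      simp only [hf, hs, Finset.mem_filter, Finset.mem_univ, true_and, Prod.mk.injEq] at hab hp hq
      have huw : u = w ∧ (S i).1.1 = (S j).1.1 := by
        rcases Int.units_eq_one_or u with rfl | rfl <;> rcases Int.units_eq_one_or w with rfl | rfl
        · simpa using hab.1
        · simp [hneg] at hab
        · simp [hneg] at hab
        · simp only [hneg, false_or] at hp hq
          exact ⟨rfl, by omega⟩
      have hij : i = j := S.injective (Subtype.ext (Prod.ext huw.2 hab.2))
      rw [huw.1, hij]
  have hTx : ∀ i, (T (e (i, 1))).1 = ((S i).1.1 + 1, (S i).1.2) := by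
    intro i
    rw [hT _ (Finset.mem_map_of_mem _ (by simp [hs])), e.injective.extend_apply]
    simp [hf]
  have hTy : ∀ i, (S i).1.1 = 0 → (T (e (i, -1))).1 = (0, (S i).1.2) := by
    intro i hi
    rw [hT _ (Finset.mem_map_of_mem _ (by simp [hs, hi])), e.injective.extend_apply]
    simp [hf, hneg]
  have hlow : (tabloid T).lower = Finset.univ.map (pairFst e) := by
    symm
    refine Finset.eq_of_subset_of_card_le (fun a ha => ?_) ?_
    · obtain ⟨i, -, rfl⟩ := Finset.mem_map.1 ha
      rw [Tabloid.mem_lower]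
      change (T (e (i, 1))).1.1 ≠ 0
      rw [hTx]
      exact Nat.succ_ne_zero _
    · rw [Finset.card_map, Tabloid.card_lower, Finset.card_univ, hK]
  -- `ε` can only exchange pairs that stand in the first two rows of one column, so that
  -- `pairSwap e ε` is a column permutation
  have key : ∀ ε : K → ℤˣ, ∀ q ∈ columnGroup T, (pairSwap e ε * q) • tabloid T = tabloid T →
      pairSwap e ε * q = 1 := by
    intro ε q hq h
    have hS0 : ∀ i, ε i = -1 → (S i).1.1 = 0 := by
      intro i hi
      by_contra hne
      have hy0 : (T (e (i, -1))).1.1 = 0 := by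
        have : e (i, -1) ∉ (tabloid T).lower := by
          rw [hlow]
          simp only [Finset.mem_map, Finset.mem_univ, true_and, not_exists]
          intro j hj
          have : (1 : ℤˣ) = -1 := congrArg Prod.snd (e.injective hj)
          exact absurd this (by decide)
        rw [Tabloid.mem_lower, not_not] at this
        exact this
      have hqy : q (e (i, -1)) = e (i, -1) := by
        refine T.injective (Subtype.ext (Prod.ext ?_ (mem_columnGroup.1 hq _)))
        rw [hy0]
        by_contra hpos
        have hmem : (0, (T (e (i, -1))).1.2) ∈ μ.deleteFirstRow.cells := by
          have hle : 0 + 1 ≤ (T (q (e (i, -1)))).1.1 := by omega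
          rw [mem_cells, mem_deleteFirstRow, ← mem_columnGroup.1 hq]
          exact μ.up_left_mem hle le_rfl ((mem_cells _).1 (T (q (e (i, -1)))).2)
        set j := S.symm ⟨_, hmem⟩ with hj
        have hSj : (S j).1 = (0, (T (e (i, -1))).1.2) := by rw [hj, apply_symm_apply]
        have hTj : (T (e (j, -1))).1 = (T (e (i, -1))).1 := by
          rw [hTy j (by rw [hSj])]
          exact Prod.ext hy0.symm (by rw [hSj])
        have hji : j = i :=
          congrArg Prod.fst (e.injective (T.injective (Subtype.ext hTj)))
        rw [hji] at hSj
        exact hne (by rw [hSj])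
      have h1 := congrArg (fun t : Tabloid μ N => t.1 (e (i, 1))) h
      have h2 : (pairSwap e ε * q).symm (e (i, 1)) = e (i, -1) := by
        rw [symm_apply_eq, Perm.mul_apply, hqy, pairSwap_apply, hi]
        simp
      change (tabloid T).1 ((pairSwap e ε * q).symm (e (i, 1))) = (T (e (i, 1))).1.1 at h1
      rw [h2] at h1
      change (T (e (i, -1))).1.1 = _ at h1
      rw [hy0, hTx] at h1
      exact (Nat.succ_ne_zero _ h1.symm).elim
    refine eq_one_of_mem_columnGroup (mul_mem_columnGroup (mem_columnGroup.2 fun a => ?_) hq) h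
    by_cases ha : a ∈ Set.range e
    · obtain ⟨⟨i, u⟩, rfl⟩ := ha
      rw [pairSwap_apply]
      rcases Int.units_eq_one_or (ε i) with hi | hi
      · rw [hi, one_mul]
      · have h0 := hS0 i hi
        rw [hi]
        rcases Int.units_eq_one_or u with rfl | rfl
        · rw [mul_one, hTy i h0, hTx]
        · rw [show (-1 : ℤˣ) * -1 = 1 by decide, hTy i h0, hTx]
    · rw [pairSwap_apply_of_notMem e ε ha]
  refine ⟨T, fun h0 => ?_⟩
  have hcoeff : (pairAlt (permModule μ N) e (polytabloid T)).coeff (tabloid T) =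
      ((∑ ε : K → ℤˣ, ∑ q ∈ columnGroup T,
        if (pairSwap e ε * q) • tabloid T = tabloid T then 1 else 0 : ℕ) : ℂ) := by
    rw [pairAlt_apply, coeff_sum_smul, Nat.cast_sum]
    refine Finset.sum_congr rfl fun ε _ => ?_
    rw [polytabloid_eq, map_sum]
    simp only [map_smul, permModule_permBasis]
    rw [coeff_sum_smul, Finset.mul_sum, Nat.cast_sum]
    refine Finset.sum_congr rfl fun q hq => ?_
    rw [smul_smul]
    split_ifs with h
    · rw [h, permBasis_coeff_self, mul_one, ← Int.cast_mul, ← Units.val_mul, ← map_mul,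
        key ε q hq h]
      simp
    · rw [permBasis_coeff_of_ne h]
      simp
  have hzero : (pairAlt (permModule μ N) e (polytabloid T)).coeff (tabloid T) = 0 := by
    rw [h0]
    rfl
  rw [hzero] at hcoeff
  have h1 : (∑ ε : K → ℤˣ, ∑ q ∈ columnGroup T,
      if (pairSwap e ε * q) • tabloid T = tabloid T then 1 else 0 : ℕ) = 0 := by
    exact_mod_cast hcoeff.symm
  rw [Finset.sum_eq_zero_iff] at h1
  have h2 := Finset.sum_eq_zero_iff.1 (h1 1 (Finset.mem_univ _)) 1 (one_mem_columnGroup T)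
  simp at h2

theorem altLift_mem_spechtSub (hK : Fintype.card K = μ.deleteFirstRow.card)
    {u : MonoidAlgebra ℂ (Tabloid μ.deleteFirstRow K)}
    (hu : u ∈ (spechtSub μ.deleteFirstRow K).toSubmodule) :
    altLift hN e u ∈ (spechtSub μ N).toSubmodule := by
  have hP : ∀ v ∈ (spechtSub μ N).toSubmodule,
      pairAlt (permModule μ N) e v ∈ (spechtSub μ N).toSubmodule := by
    intro v hv
    rw [pairAlt_apply]
    exact Submodule.sum_mem _ fun ε _ =>
      Submodule.smul_mem _ _ ((spechtSub μ N).apply_mem_toSubmodule _ hv)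
  obtain ⟨T, hT⟩ := exists_pairAlt_polytabloid_ne_zero hN e hK
  have hTP := hP _ (polytabloid_mem T)
  refine spechtSub_le_of_mem (N := (spechtSub μ N).toSubmodule.comap (altLift hN e)) ?_
    (unliftMap_mem_spechtSub hN (pairFst e) hTP) ?_ ?_ hu
  · intro π w hw
    rw [Submodule.mem_comap, ← permModule_pairPerm_altLift]
    exact (spechtSub μ N).apply_mem_toSubmodule _ hw
  · rw [Submodule.mem_comap, altLift_unliftMap_pairAlt hN e hK]
    exact hTP
  · intro h
    refine hT ?_
    rw [← altLift_unliftMap_pairAlt hN e hK, h, map_zero]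

/-- The pair-alternating part of the Specht module of `μ` is the Specht module of `μ` without its
first row. -/
theorem exists_pairAlt_eq_altLift_of_mem (hK : Fintype.card K = μ.deleteFirstRow.card)
    {v : MonoidAlgebra ℂ (Tabloid μ N)}
    (hv : v ∈ (spechtSub μ N).toSubmodule) :
    ∃ u ∈ (spechtSub μ.deleteFirstRow K).toSubmodule,
      pairAlt (permModule μ N) e v = altLift hN e u := by
  refine ⟨_, unliftMap_mem_spechtSub hN (pairFst e) ?_,
    (altLift_unliftMap_pairAlt hN e hK v).symm⟩
  rw [pairAlt_apply]
  exact Submodule.sum_mem _ fun ε _ =>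
    Submodule.smul_mem _ _ ((spechtSub μ N).apply_mem_toSubmodule _ hv)

end

/-! ### Homomorphisms out of a Specht module -/

section

variable {μ : YoungDiagram} {K N : Type} [Fintype K] [DecidableEq K] [Fintype N] [DecidableEq N]
  (hN : μ.card = Fintype.card N) (e : K × ℤˣ ↪ N)
  {V : Type} [AddCommMonoid V] [Module ℂ V] (τ : Representation ℂ (Perm N) V)

open scoped Classical in
/-- An equivariant map from `M^σ` to the pair-alternating vectors of `V` comes from an equivariant
map `M^μ → V`, if antisymmetrizing the vectors of `V` that are fixed by the permutations fixing the
first members gives all pair-alternating vectors.  The image of the lift `t₀'` of a tabloid `t₀` has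
to be a vector that is fixed by the stabilizer of `t₀'` and whose antisymmetrization is prescribed;
it is obtained by averaging over this stabilizer. -/
theorem exists_equivariant_extension (hK : Fintype.card K = μ.deleteFirstRow.card)
    (hτ : ∀ v, pairAlt τ e v ∈ (letterFixed τ (pairFst e)).map (pairAlt τ e))
    (f : MonoidAlgebra ℂ (Tabloid μ.deleteFirstRow K) →ₗ[ℂ] V)
    (hf : ∀ π u, f (permModule _ K π u) = τ (pairPerm e π) (f u))
    (hfa : ∀ u, IsPairAlternating τ e (f u)) :
    ∃ φ : MonoidAlgebra ℂ (Tabloid μ N) →ₗ[ℂ] V,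
      (∀ g v, φ (permModule μ N g v) = τ g (φ v)) ∧ ∀ u, φ (altLift hN e u) = f u := by
  obtain ⟨S⟩ : Nonempty (K ≃ μ.deleteFirstRow.cells) :=
    ⟨Fintype.equivOfCardEq (by rw [hK, Fintype.card_coe])⟩
  set t₀ := tabloid S
  set t₁ := t₀.lift hN (pairFst e) with ht₁
  obtain ⟨w₀, hw₀⟩ := (hfa (permBasis _ _ t₀)).exists_pairAlt_eq
  obtain ⟨w, hw, hPw⟩ := hτ w₀
  rw [hw₀] at hPw
  set D : Finset (Perm N) := Finset.univ.filter fun g => g • t₁ = t₁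
  have hD : (D.card : ℂ) ≠ 0 := by
    have : 1 ∈ D := by simp [D]
    exact_mod_cast Finset.card_ne_zero_of_mem this
  set φ : MonoidAlgebra ℂ (Tabloid μ N) →ₗ[ℂ] V := (permBasis μ N).constr ℂ fun t =>
    (D.card : ℂ)⁻¹ • ∑ g ∈ Finset.univ.filter (fun g : Perm N => g • t₁ = t), τ g w with hφ
  have hφb : ∀ t, φ (permBasis μ N t) =
      (D.card : ℂ)⁻¹ • ∑ g ∈ Finset.univ.filter (fun g : Perm N => g • t₁ = t), τ g w :=
    fun t => Module.Basis.constr_basis _ _ _ _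
  have hequi : ∀ g v, φ (permModule μ N g v) = τ g (φ v) := by
    intro g v
    have : φ ∘ₗ permModule μ N g = τ g ∘ₗ φ := by
      refine (permBasis _ _).ext fun t => ?_
      rw [LinearMap.comp_apply, LinearMap.comp_apply, permModule_permBasis, hφb, hφb, map_smul,
        map_sum]
      congr 1
      symm
      refine Finset.sum_equiv (Equiv.mulLeft g) (fun h => ?_) fun h _ => ?_
      · simp [mul_smul]
      · rw [Equiv.coe_mulLeft, map_mul, Module.End.mul_apply]
    exact LinearMap.congr_fun this v
  refine ⟨φ, hequi, fun u => ?_⟩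
  -- on the tabloid `t₁` itself, the antisymmetrization of every summand is the same
  have hPφ : pairAlt τ e (φ (permBasis μ N t₁)) = f (permBasis _ _ t₀) := by
    have hterm : ∀ g ∈ D, pairAlt τ e (τ g w) = f (permBasis _ _ t₀) := by
      intro g hg
      have hg1 : g • t₁ = t₁ := (Finset.mem_filter.1 hg).2
      have hex : ∀ i, ∃ j, pairFst e j = g (pairFst e i) := by
        intro i
        have : g (pairFst e i) ∈ t₁.lower := by
          rw [← hg1, Tabloid.smul_mem_lower, Tabloid.mem_lower_lift]
          exact ⟨i, rfl⟩
        exact (Tabloid.mem_lower_lift _ _).1 this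
      choose p hp using hex
      have hpinj : Function.Injective p := fun i j hij => by
        refine (pairFst e).injective (g.injective ?_)
        rw [← hp, ← hp, hij]
      set π : Perm K := Equiv.ofBijective p (Finite.injective_iff_bijective.1 hpinj)
      have hπ : ∀ i, g (pairFst e i) = pairFst e (π i) := fun i => (hp i).symm
      have hπt : π • t₀ = t₀ := by
        refine Tabloid.lift_injective hN (pairFst e) ?_
        rw [← Tabloid.smul_lift hN (pairFst e) hπ, ← ht₁, hg1]
      have hgw : τ g w = τ (pairPerm e π) w := by
        have h1 : τ ((pairPerm e π)⁻¹ * g) w = w := hw _ fun i => by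
          rw [Perm.mul_apply, hπ, Perm.inv_def, symm_apply_eq]
          exact (pairPerm_apply e π i 1).symm
        have h2 := congrArg (τ (pairPerm e π)) h1
        rwa [← Module.End.mul_apply, ← map_mul, mul_inv_cancel_left] at h2
      rw [hgw, pairAlt_pairPerm, hPw, ← hf, permModule_permBasis, hπt]
    rw [hφb, map_smul, map_sum, Finset.sum_congr rfl hterm, Finset.sum_const,
      ← Nat.cast_smul_eq_nsmul ℂ, smul_smul, inv_mul_cancel₀ hD, one_smul]
  have : φ ∘ₗ altLift hN e = f := by
    refine (permBasis _ _).ext fun t => ?_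
    obtain ⟨π, rfl⟩ := Tabloid.exists_smul_eq t₀ t
    rw [LinearMap.comp_apply, ← permModule_permBasis, ← permModule_pairPerm_altLift, hequi, hf,
      altLift_apply, liftMap_permBasis, map_pairAlt φ hequi, hPφ]
  exact LinearMap.congr_fun this u

/-- The inclusion of the Specht module of `μ` without its first row into the Specht module of `μ`,
with the pair-alternating vectors as image. -/
noncomputable def spechtLift (hK : Fintype.card K = μ.deleteFirstRow.card) :
    (spechtSub μ.deleteFirstRow K).toSubmodule →ₗ[ℂ] (spechtSub μ N).toSubmodule :=
  (altLift hN e).restrict fun _ hu => altLift_mem_spechtSub hN e hK hu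

theorem coe_spechtLift (hK : Fintype.card K = μ.deleteFirstRow.card)
    (u : (spechtSub μ.deleteFirstRow K).toSubmodule) :
    (spechtLift hN e hK u : MonoidAlgebra ℂ (Tabloid μ N)) = altLift hN e u := rfl

theorem coe_specht {α : Type} [Fintype α] [DecidableEq α] (g : Perm α)
    (v : (spechtSub μ α).toSubmodule) :
    (specht μ α g v : MonoidAlgebra ℂ (Tabloid μ α)) = permModule μ α g v := rfl

theorem specht_pairPerm_spechtLift (hK : Fintype.card K = μ.deleteFirstRow.card) (π : Perm K)
    (u : (spechtSub μ.deleteFirstRow K).toSubmodule) :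
    specht μ N (pairPerm e π) (spechtLift hN e hK u) = spechtLift hN e hK (specht _ K π u) := by
  refine Subtype.ext ?_
  rw [coe_specht, coe_spechtLift, coe_spechtLift, coe_specht, permModule_pairPerm_altLift]

theorem isPairAlternating_spechtLift (hK : Fintype.card K = μ.deleteFirstRow.card)
    (u : (spechtSub μ.deleteFirstRow K).toSubmodule) :
    IsPairAlternating (specht μ N) e (spechtLift hN e hK u) := fun ε =>
  Subtype.ext (isPairAlternating_pairAlt (permModule μ N) e _ ε)

/-- Multiplicities of `S^μ` can be computed as multiplicities of `S^σ`, `σ` being `μ` without its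
first row, in the pair-alternating vectors. -/
theorem repMultiplicity_specht_eq (hN : μ.card = Fintype.card N) (e : K × ℤˣ ↪ N)
    (τ : Representation ℂ (Perm N) V) (hK : Fintype.card K = μ.deleteFirstRow.card)
    (hτ : ∀ v, pairAlt τ e v ∈ (letterFixed τ (pairFst e)).map (pairAlt τ e))
    {Y : Type} [AddCommGroup Y] [Module ℂ Y] (κ : Representation ℂ (Perm K) Y) (F : Y →ₗ[ℂ] V)
    (hFinj : Function.Injective F) (hFκ : ∀ π y, F (κ π y) = τ (pairPerm e π) (F y))
    (hFalt : ∀ y, IsPairAlternating τ e (F y))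
    (hFsurj : ∀ v, IsPairAlternating τ e v → ∃ y, F y = v) :
    repMultiplicity (specht μ N) τ = repMultiplicity (specht μ.deleteFirstRow K) κ := by
  let _ : AddCommGroup V := Module.addCommMonoidToAddCommGroup ℂ
  obtain ⟨G, hG⟩ := F.exists_leftInverse_of_injective (LinearMap.ker_eq_bot.2 hFinj)
  have hGF : ∀ y, G (F y) = y := fun y => LinearMap.congr_fun hG y
  have hFG : ∀ v, IsPairAlternating τ e v → F (G v) = v := by
    intro v hv
    obtain ⟨y, rfl⟩ := hFsurj v hv
    rw [hGF]
  have halt : ∀ (φ : Representation.IntertwiningMap (specht μ N) τ)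
      (u : (spechtSub μ.deleteFirstRow K).toSubmodule),
      IsPairAlternating τ e (φ (spechtLift hN e hK u)) := by
    intro φ u ε
    rw [← φ.isIntertwining, isPairAlternating_spechtLift hN e hK u, map_smul]
  have hFφ : ∀ (φ : Representation.IntertwiningMap (specht μ N) τ)
      (u : (spechtSub μ.deleteFirstRow K).toSubmodule),
      F (G (φ (spechtLift hN e hK u))) = φ (spechtLift hN e hK u) :=
    fun φ u => hFG _ (halt φ u)
  let Ψ : Representation.IntertwiningMap (specht μ N) τ →ₗ[ℂ]
      Representation.IntertwiningMap (specht μ.deleteFirstRow K) κ :=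
    { toFun := fun φ => ⟨G ∘ₗ φ.toLinearMap ∘ₗ spechtLift hN e hK, fun π => by
        refine LinearMap.ext fun u => hFinj ?_
        change F (G (φ (spechtLift hN e hK (specht _ K π u)))) =
          F (κ π (G (φ (spechtLift hN e hK u))))
        rw [hFκ, hFφ, hFφ, ← specht_pairPerm_spechtLift, φ.isIntertwining]⟩
      map_add' := fun φ ψ => by
        refine Representation.IntertwiningMap.ext (LinearMap.ext fun u => ?_)
        exact G.map_add _ _
      map_smul' := fun c φ => by
        refine Representation.IntertwiningMap.ext (LinearMap.ext fun u => ?_)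
        exact G.map_smul _ _ }
  have hΨ : ∀ φ u, F (Ψ φ u) = φ (spechtLift hN e hK u) := hFφ
  refine LinearEquiv.finrank_eq (LinearEquiv.ofBijective Ψ ⟨?_, ?_⟩)
  · rw [← LinearMap.ker_eq_bot, LinearMap.ker_eq_bot']
    intro φ hφ
    obtain ⟨S⟩ : Nonempty (K ≃ μ.deleteFirstRow.cells) :=
      ⟨Fintype.equivOfCardEq (by rw [hK, Fintype.card_coe])⟩
    set u : (spechtSub μ.deleteFirstRow K).toSubmodule := ⟨polytabloid S, polytabloid_mem S⟩
    have hu : φ (spechtLift hN e hK u) = 0 := by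
      rw [← hΨ, hφ]
      exact F.map_zero
    have hle := spechtSub_le_of_mem
      (N := (LinearMap.ker φ.toLinearMap).map (spechtSub μ N).toSubmodule.subtype) ?_
      (spechtLift hN e hK u).2 ⟨_, hu, rfl⟩ ?_
    · refine Representation.IntertwiningMap.ext (LinearMap.ext fun v => ?_)
      obtain ⟨v', hv', hvv⟩ := hle v.2
      rw [← Subtype.ext hvv]
      exact hv'
    · rintro g _ ⟨v, hv, rfl⟩
      refine ⟨specht μ N g v, ?_, rfl⟩
      have hv' : φ v = 0 := hv
      change φ (specht μ N g v) = 0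
      rw [φ.isIntertwining, hv', map_zero]
    · rw [coe_spechtLift]
      exact (map_ne_zero_iff _ (altLift_injective hN e)).2 (polytabloid_ne_zero S)
  · intro ψ
    obtain ⟨p, hp, hpS⟩ := (spechtSub μ.deleteFirstRow K).exists_equivariant_retraction
    obtain ⟨φ, hφ, hφf⟩ := exists_equivariant_extension hN e τ hK hτ
      (F ∘ₗ ψ.toLinearMap ∘ₗ p) (fun π u => by
        change F (ψ (p (permModule _ K π u))) = τ (pairPerm e π) (F (ψ (p u)))
        rw [hp, ← hFκ, ← ψ.isIntertwining]
        rfl) fun u => hFalt _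
    refine ⟨⟨φ ∘ₗ (spechtSub μ N).toSubmodule.subtype, fun g => LinearMap.ext fun v => hφ g v⟩, ?_⟩
    refine Representation.IntertwiningMap.ext (LinearMap.ext fun u => hFinj ?_)
    refine (hΨ _ u).trans ?_
    change φ (altLift hN e u) = F (ψ u)
    rw [hφf]
    change F (ψ (p u)) = F (ψ u)
    rw [hpS]

end

end YoungDiagram

/-! ### Maps out of an induced representation -/

section Induced

variable {G H W V Y : Type} [Group G] [Group H] [AddCommGroup W] [Module ℂ W]
  [AddCommGroup V] [Module ℂ V] [AddCommGroup Y] [Module ℂ Y]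

theorem Representation.IndV.mk_mul (φ : G →* H) (ρ : Representation ℂ G W) (x : G) (h : H)
    (w : W) :
    Representation.IndV.mk φ ρ (φ x * h) (ρ x w) = Representation.IndV.mk φ ρ h w := by
  have := Representation.Coinvariants.mk_self_apply
    (Representation.tprod ((Representation.leftRegular ℂ H).comp φ) ρ) x
    (MonoidAlgebra.single h 1 ⊗ₜ[ℂ] w)
  simpa using this

/-- The equivariant map out of an induced representation that extends an equivariant map `θ`. -/
noncomputable def Representation.IndV.lift (φ : G →* H) (ρ : Representation ℂ G W)
    (τ : Representation ℂ H V) (θ : W →ₗ[ℂ] V) (hθ : ∀ x w, τ (φ x) (θ w) = θ (ρ x w)) :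
    Representation.IndV φ ρ →ₗ[ℂ] V :=
  Representation.Coinvariants.lift _
    (TensorProduct.lift <| (Finsupp.lift _ _ _ fun h : H => τ h⁻¹ ∘ₗ θ) ∘ₗ
        (MonoidAlgebra.coeffLinearEquiv ℂ).toLinearMap)
    fun x => by
      refine TensorProduct.ext (MonoidAlgebra.lhom_ext' fun h => LinearMap.ext_ring
        (LinearMap.ext fun w => ?_))
      simp [Representation.ofMulAction_single, mul_inv_rev, ← hθ]

theorem Representation.IndV.lift_mk (φ : G →* H) (ρ : Representation ℂ G W)
    (τ : Representation ℂ H V) (θ : W →ₗ[ℂ] V) (hθ : ∀ x w, τ (φ x) (θ w) = θ (ρ x w)) (h : H)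
    (w : W) :
    Representation.IndV.lift φ ρ τ θ hθ (Representation.IndV.mk φ ρ h w) = τ h⁻¹ (θ w) := by
  simp [Representation.IndV.lift]

theorem Representation.IndV.lift_ind (φ : G →* H) (ρ : Representation ℂ G W)
    (τ : Representation ℂ H V) (θ : W →ₗ[ℂ] V) (hθ : ∀ x w, τ (φ x) (θ w) = θ (ρ x w)) (h : H)
    (z : Representation.IndV φ ρ) :
    Representation.IndV.lift φ ρ τ θ hθ (Representation.ind φ ρ h z) =
      τ h (Representation.IndV.lift φ ρ τ θ hθ z) := by
  have : Representation.IndV.lift φ ρ τ θ hθ ∘ₗ Representation.ind φ ρ h =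
      τ h ∘ₗ Representation.IndV.lift φ ρ τ θ hθ := by
    refine Representation.IndV.hom_ext φ ρ fun k => LinearMap.ext fun w => ?_
    change Representation.IndV.lift φ ρ τ θ hθ
      (Representation.ind φ ρ h (Representation.IndV.mk φ ρ k w)) =
        τ h (Representation.IndV.lift φ ρ τ θ hθ (Representation.IndV.mk φ ρ k w))
    rw [Representation.ind_mk, Representation.IndV.lift_mk, Representation.IndV.lift_mk,
      mul_inv_rev, inv_inv, map_mul]
    rfl
  exact LinearMap.congr_fun this z

theorem Representation.IndV.exists_eq_sum_mk [Fintype H] (φ : G →* H) (ρ : Representation ℂ G W)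
    (z : Representation.IndV φ ρ) :
    ∃ w : H → W, z = ∑ h, Representation.IndV.mk φ ρ h (w h) := by
  induction z using Representation.Coinvariants.induction_on with
  | _ x =>
    induction x using TensorProduct.induction_on with
    | zero => exact ⟨0, by simp⟩
    | tmul a w =>
      refine ⟨fun h => a.coeff h • w, ?_⟩
      have h1 : a = ∑ h, a.coeff h • MonoidAlgebra.single h (1 : ℂ) :=
        ((Module.Basis.ofRepr (MonoidAlgebra.coeffLinearEquiv ℂ) :
          Module.Basis H ℂ (MonoidAlgebra ℂ H)).sum_repr a).symm
      conv_lhs => rw [h1]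
      rw [TensorProduct.sum_tmul, map_sum]
      refine Finset.sum_congr rfl fun h _ => ?_
      rw [map_smul, ← TensorProduct.smul_tmul', map_smul]
      rfl
    | add x y hx hy =>
      obtain ⟨v, hv⟩ := hx
      obtain ⟨w, hw⟩ := hy
      exact ⟨v + w, by simp only [map_add, hv, hw, Pi.add_apply, Finset.sum_add_distrib]⟩

/-- A linear map out of an induced representation is injective if the summands belonging to the
cosets of `G` can be told apart, `c h` being a functional that detects the coset of `h`. -/
theorem Representation.IndV.injective_of_detect [Fintype G] [Fintype H] (φ : G →* H)
    (hφ : Function.Injective φ) (ρ : Representation ℂ G W)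
    (F : Representation.IndV φ ρ →ₗ[ℂ] V) (c : H → V →ₗ[ℂ] Y)
    (ι : W →ₗ[ℂ] Y) (hι : Function.Injective ι)
    (h0 : ∀ h k w, h * k⁻¹ ∉ φ.range → c h (F (Representation.IndV.mk φ ρ k w)) = 0)
    (h1 : ∀ x k w, c (φ x * k) (F (Representation.IndV.mk φ ρ k w)) = ι (ρ x w)) :
    Function.Injective F := by
  rw [← LinearMap.ker_eq_bot, LinearMap.ker_eq_bot']
  intro z hz
  obtain ⟨w, rfl⟩ := Representation.IndV.exists_eq_sum_mk φ ρ z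
  -- the vectors `w h` themselves need not vanish, only their sums over cosets, transported by `ρ`
  have hvanish : ∀ h, ∑ x, ρ x (w ((φ x)⁻¹ * h)) = 0 := by
    intro h
    refine hι ?_
    rw [map_zero, map_sum, ← (c h).map_zero, ← hz, map_sum, map_sum]
    refine Finset.sum_of_injOn (fun x => (φ x)⁻¹ * h) ?_
      (fun _ _ => Finset.mem_coe.2 (Finset.mem_univ _)) ?_ ?_
    · intro x _ y _ hxy
      exact hφ (inv_injective (mul_right_cancel hxy))
    · intro k _ hk
      refine h0 h k _ fun ⟨x, hx⟩ => hk ⟨x, Finset.mem_coe.2 (Finset.mem_univ _), ?_⟩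
      simp [hx]
    · intro x _
      rw [← h1, mul_inv_cancel_left]
  have hG : (Fintype.card G : ℂ) ≠ 0 := by exact_mod_cast Fintype.card_ne_zero
  have hsum : (Fintype.card G : ℂ) • ∑ h, Representation.IndV.mk φ ρ h (w h) = 0 := by
    calc (Fintype.card G : ℂ) • ∑ h, Representation.IndV.mk φ ρ h (w h)
        = ∑ x : G, ∑ h, Representation.IndV.mk φ ρ (φ x * h) (ρ x (w h)) := by
          simp only [Representation.IndV.mk_mul, Finset.sum_const, Finset.card_univ,
            Nat.cast_smul_eq_nsmul]
      _ = ∑ x : G, ∑ h, Representation.IndV.mk φ ρ h (ρ x (w ((φ x)⁻¹ * h))) := by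
          refine Finset.sum_congr rfl fun x _ => ?_
          refine Fintype.sum_equiv (Equiv.mulLeft (φ x)) _ _ fun h => ?_
          rw [Equiv.coe_mulLeft, inv_mul_cancel_left]
      _ = 0 := by
          rw [Finset.sum_comm]
          refine Finset.sum_eq_zero fun h _ => ?_
          rw [← map_sum, hvanish, map_zero]
  exact (smul_eq_zero.1 hsum).resolve_left hG

end Induced

/-! ### Induced representations of pair-alternating vectors -/

section PairsInduced

variable {μ : YoungDiagram} {K N G W V Y : Type} [Fintype K] [DecidableEq K] [Fintype N]
  [DecidableEq N] [Group G] [Fintype G] [AddCommGroup W] [Module ℂ W] [AddCommMonoid V] [Module ℂ V]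
  [AddCommMonoid Y] [Module ℂ Y]

/-- The multiplicity of `S^μ` in a representation `τ` whose pair-alternating vectors form an induced
representation.  The copy `θ` of the inducing representation `ρ` has to span them under the
permutations of the pairs, and the map `q` tells this copy apart from its translates. -/
theorem YoungDiagram.repMultiplicity_specht_eq_ind (hN : μ.card = Fintype.card N)
    (e : K × ℤˣ ↪ N) (τ : Representation ℂ (Perm N) V)
    (hK : Fintype.card K = μ.deleteFirstRow.card)
    (hτ : ∀ v, pairAlt τ e v ∈ (letterFixed τ (pairFst e)).map (pairAlt τ e))
    (φ : G →* Perm K) (hφ : Function.Injective φ) (ρ : Representation ℂ G W) (θ : W →ₗ[ℂ] V)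
    (hθ : ∀ x w, τ (pairPerm e (φ x)) (θ w) = θ (ρ x w))
    (hθalt : ∀ w, IsPairAlternating τ e (θ w)) (q : V →ₗ[ℂ] Y) (ι : W →ₗ[ℂ] Y)
    (hι : Function.Injective ι)
    (hq0 : ∀ h ∉ φ.range, ∀ w, q (τ (pairPerm e h) (θ w)) = 0) (hq1 : ∀ w, q (θ w) = ι w)
    (hspan : ∀ Q : Submodule ℂ V, (∀ π w, τ (pairPerm e π) (θ w) ∈ Q) → ∀ v, pairAlt τ e v ∈ Q) :
    repMultiplicity (specht μ N) τ =
      repMultiplicity (specht μ.deleteFirstRow K) (Representation.ind φ ρ) := by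
  let _ : AddCommGroup V := Module.addCommMonoidToAddCommGroup ℂ
  let _ : AddCommGroup Y := Module.addCommMonoidToAddCommGroup ℂ
  set F := Representation.IndV.lift φ ρ (τ.comp (pairPerm e)) θ hθ with hF
  have hFmk : ∀ h w, F (Representation.IndV.mk φ ρ h w) = τ (pairPerm e h⁻¹) (θ w) :=
    fun h w => Representation.IndV.lift_mk _ _ _ _ hθ h w
  refine repMultiplicity_specht_eq hN e τ hK hτ (Representation.ind φ ρ) F ?_
    (fun h z => Representation.IndV.lift_ind _ _ _ _ hθ h z) ?_ ?_
  · refine Representation.IndV.injective_of_detect φ hφ ρ F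
      (fun h => q ∘ₗ τ (pairPerm e h)) ι hι ?_ ?_
    · intro h k w hhk
      rw [hFmk, LinearMap.comp_apply, ← Module.End.mul_apply, ← map_mul, ← map_mul]
      exact hq0 _ hhk w
    · intro x k w
      rw [hFmk, LinearMap.comp_apply, ← Module.End.mul_apply, ← map_mul, ← map_mul,
        mul_inv_cancel_right, hθ, hq1]
  · intro z
    obtain ⟨w, rfl⟩ := Representation.IndV.exists_eq_sum_mk φ ρ z
    intro ε
    rw [map_sum, map_sum, Finset.smul_sum]
    refine Finset.sum_congr rfl fun h _ => ?_
    rw [hFmk]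
    exact (hθalt (w h)).pairPerm h⁻¹ ε
  · intro v hv
    obtain ⟨v, rfl⟩ := hv.exists_pairAlt_eq
    refine hspan (LinearMap.range F) (fun π w => ⟨Representation.IndV.mk φ ρ π⁻¹ w, ?_⟩) v
    rw [hFmk, inv_inv]

open scoped TensorProduct in
/-- The case of `YoungDiagram.repMultiplicity_specht_eq_ind` in which the inducing representation is
an external tensor product, with separate additive groups for the two factors: for submodules as
factors, the group structure of the tensor product is then found by instance search. -/
theorem YoungDiagram.repMultiplicity_specht_eq_ind_externalTensor {H X₁ X₂ : Type} [Group H]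
    [Fintype H] [AddCommGroup X₁] [Module ℂ X₁] [AddCommGroup X₂] [Module ℂ X₂]
    (hN : μ.card = Fintype.card N) (e : K × ℤˣ ↪ N) (τ : Representation ℂ (Perm N) V)
    (hK : Fintype.card K = μ.deleteFirstRow.card)
    (hτ : ∀ v, pairAlt τ e v ∈ (letterFixed τ (pairFst e)).map (pairAlt τ e))
    (φ : G × H →* Perm K) (hφ : Function.Injective φ) (ρ₁ : Representation ℂ G X₁)
    (ρ₂ : Representation ℂ H X₂) (θ : X₁ ⊗[ℂ] X₂ →ₗ[ℂ] V)
    (hθ : ∀ x w, τ (pairPerm e (φ x)) (θ w) = θ (externalTensor ρ₁ ρ₂ x w))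
    (hθalt : ∀ w, IsPairAlternating τ e (θ w)) (q : V →ₗ[ℂ] Y) (ι : X₁ ⊗[ℂ] X₂ →ₗ[ℂ] Y)
    (hι : Function.Injective ι)
    (hq0 : ∀ h ∉ φ.range, ∀ w, q (τ (pairPerm e h) (θ w)) = 0) (hq1 : ∀ w, q (θ w) = ι w)
    (hspan : ∀ Q : Submodule ℂ V, (∀ π w, τ (pairPerm e π) (θ w) ∈ Q) → ∀ v, pairAlt τ e v ∈ Q) :
    repMultiplicity (specht μ N) τ =
      repMultiplicity (specht μ.deleteFirstRow K)
        (Representation.ind φ (externalTensor ρ₁ ρ₂)) :=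
  repMultiplicity_specht_eq_ind hN e τ hK hτ φ hφ _ θ hθ hθalt q ι hι hq0 hq1 hspan

end PairsInduced

open scoped TensorProduct

/-! ### Pairs indexed by a disjoint union -/

section PairsSum

variable {A B N : Type}

/-- The pairs with index in the first summand. -/
def pairInl (e : (A ⊕ B) × ℤˣ ↪ N) : A × ℤˣ ↪ N :=
  ⟨fun p => e (Sum.inl p.1, p.2), fun p q h => by
    have := e.injective h
    simp only [Prod.mk.injEq, Sum.inl.injEq] at this
    exact Prod.ext this.1 this.2⟩

/-- The pairs with index in the second summand. -/
def pairInr (e : (A ⊕ B) × ℤˣ ↪ N) : B × ℤˣ ↪ N :=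
  ⟨fun p => e (Sum.inr p.1, p.2), fun p q h => by
    have := e.injective h
    simp only [Prod.mk.injEq, Sum.inr.injEq] at this
    exact Prod.ext this.1 this.2⟩

theorem pairInl_apply (e : (A ⊕ B) × ℤˣ ↪ N) (i : A) (u : ℤˣ) :
    pairInl e (i, u) = e (Sum.inl i, u) := rfl

theorem pairInr_apply (e : (A ⊕ B) × ℤˣ ↪ N) (i : B) (u : ℤˣ) :
    pairInr e (i, u) = e (Sum.inr i, u) := rfl

theorem pairSwap_pairInl (e : (A ⊕ B) × ℤˣ ↪ N) (ε : A ⊕ B → ℤˣ) (p : A × ℤˣ) :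
    pairSwap e ε (pairInl e p) = pairSwap (pairInl e) (ε ∘ Sum.inl) (pairInl e p) := by
  obtain ⟨i, u⟩ := p
  rw [pairSwap_apply, pairInl_apply, pairSwap_apply, pairInl_apply]
  rfl

theorem pairSwap_pairInr (e : (A ⊕ B) × ℤˣ ↪ N) (ε : A ⊕ B → ℤˣ) (p : B × ℤˣ) :
    pairSwap e ε (pairInr e p) = pairSwap (pairInr e) (ε ∘ Sum.inr) (pairInr e p) := by
  obtain ⟨i, u⟩ := p
  rw [pairSwap_apply, pairInr_apply, pairSwap_apply, pairInr_apply]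
  rfl

theorem pairPerm_pairInl (e : (A ⊕ B) × ℤˣ ↪ N) (x : Perm A × Perm B) (p : A × ℤˣ) :
    pairPerm e (Perm.sumCongrHom A B x) (pairInl e p) = pairPerm (pairInl e) x.1 (pairInl e p) := by
  obtain ⟨i, u⟩ := p
  rw [pairPerm_apply, pairInl_apply, pairPerm_apply, pairInl_apply]
  simp

theorem pairPerm_pairInr (e : (A ⊕ B) × ℤˣ ↪ N) (x : Perm A × Perm B) (p : B × ℤˣ) :
    pairPerm e (Perm.sumCongrHom A B x) (pairInr e p) = pairPerm (pairInr e) x.2 (pairInr e p) := by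
  obtain ⟨i, u⟩ := p
  rw [pairPerm_apply, pairInr_apply, pairPerm_apply, pairInr_apply]
  simp

variable [Fintype A] [DecidableEq A] [Fintype B] [DecidableEq B] [Fintype N] [DecidableEq N]

theorem sign_pairSwap_sum (e : (A ⊕ B) × ℤˣ ↪ N) (ε : A ⊕ B → ℤˣ) :
    Perm.sign (pairSwap e ε) = Perm.sign (pairSwap (pairInl e) (ε ∘ Sum.inl)) *
      Perm.sign (pairSwap (pairInr e) (ε ∘ Sum.inr)) := by
  rw [sign_pairSwap, sign_pairSwap, sign_pairSwap, Fintype.prod_sum_type]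
  rfl

variable {V W : Type} [AddCommMonoid V] [Module ℂ V] [AddCommMonoid W] [Module ℂ W]

theorem IsPairAlternating.tmul {ρ : Representation ℂ (Perm N) V} {τ : Representation ℂ (Perm N) W}
    {e : (A ⊕ B) × ℤˣ ↪ N} {v : V} {w : W}
    (hv : IsPairAlternating ρ (pairInl e) v) (hw : IsPairAlternating τ (pairInr e) w)
    (hv' : ∀ ε, ρ (pairSwap e ε) v = ρ (pairSwap (pairInl e) (ε ∘ Sum.inl)) v)
    (hw' : ∀ ε, τ (pairSwap e ε) w = τ (pairSwap (pairInr e) (ε ∘ Sum.inr)) w) :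
    IsPairAlternating (ρ.tprod τ) e (v ⊗ₜ[ℂ] w) := by
  intro ε
  rw [Representation.tprod_apply, TensorProduct.map_tmul, hv', hw', hv, hw, sign_pairSwap_sum,
    TensorProduct.smul_tmul_smul, Units.val_mul, Int.cast_mul]

/-- The antisymmetrizer of a tensor product whose factors are only affected by the pairs of one
summand each. -/
theorem pairAlt_tmul {ρ : Representation ℂ (Perm N) V} {τ : Representation ℂ (Perm N) W}
    {e : (A ⊕ B) × ℤˣ ↪ N} {v : V} {w : W}
    (hv' : ∀ ε, ρ (pairSwap e ε) v = ρ (pairSwap (pairInl e) (ε ∘ Sum.inl)) v)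
    (hw' : ∀ ε, τ (pairSwap e ε) w = τ (pairSwap (pairInr e) (ε ∘ Sum.inr)) w) :
    pairAlt (ρ.tprod τ) e (v ⊗ₜ[ℂ] w) =
      pairAlt ρ (pairInl e) v ⊗ₜ[ℂ] pairAlt τ (pairInr e) w := by
  simp only [pairAlt_apply]
  rw [TensorProduct.sum_tmul]
  simp only [TensorProduct.tmul_sum]
  rw [← Fintype.sum_prod_type' (f := fun (δ : A → ℤˣ) (η : B → ℤˣ) =>
    (((Perm.sign (pairSwap (pairInl e) δ) : ℤ) : ℂ) • ρ (pairSwap (pairInl e) δ) v) ⊗ₜ[ℂ]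
      (((Perm.sign (pairSwap (pairInr e) η) : ℤ) : ℂ) • τ (pairSwap (pairInr e) η) w))]
  refine Fintype.sum_equiv (Equiv.sumArrowEquivProdArrow A B ℤˣ) _ _ fun ε => ?_
  rw [Representation.tprod_apply, TensorProduct.map_tmul, hv', hw', sign_pairSwap_sum,
    TensorProduct.smul_tmul_smul, Units.val_mul, Int.cast_mul]
  rfl

end PairsSum

namespace YoungDiagram

/-! ### Tensor products of permutation modules -/

section

variable {Λ Ω : YoungDiagram} {N : Type}

theorem tprod_permModule_tmul (g : Perm N) (t : Tabloid Λ N) (u : Tabloid Ω N) :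
    (permModule Λ N).tprod (permModule Ω N) g (permBasis Λ N t ⊗ₜ[ℂ] permBasis Ω N u) =
      permBasis Λ N (g • t) ⊗ₜ[ℂ] permBasis Ω N (g • u) := by
  rw [Representation.tprod_apply, TensorProduct.map_tmul, permModule_permBasis,
    permModule_permBasis]

theorem tmul_permBasis_le {Q : Submodule ℂ
      (MonoidAlgebra ℂ (Tabloid Λ N) ⊗[ℂ] MonoidAlgebra ℂ (Tabloid Ω N))}
    (h : ∀ t u, permBasis Λ N t ⊗ₜ[ℂ] permBasis Ω N u ∈ Q) (m) : m ∈ Q := by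
  have hle : ⊤ ≤ Q := by
    rw [← ((permBasis Λ N).tensorProduct (permBasis Ω N)).span_eq]
    refine Submodule.span_le.2 ?_
    rintro _ ⟨⟨t, u⟩, rfl⟩
    rw [Module.Basis.tensorProduct_apply]
    exact h t u
  exact hle Submodule.mem_top

variable [Fintype N] {A B : Type} (hΛ : Λ.card = Fintype.card N) (hΩ : Ω.card = Fintype.card N)

theorem permModule_pairSwap_lift_inl [Fintype A] (e : (A ⊕ B) × ℤˣ ↪ N)
    (t : Tabloid Λ.deleteFirstRow A) (ε : A ⊕ B → ℤˣ) :
    permModule Λ N (pairSwap e ε) (permBasis Λ N (t.lift hΛ (pairFst (pairInl e)))) =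
      permModule Λ N (pairSwap (pairInl e) (ε ∘ Sum.inl))
        (permBasis Λ N (t.lift hΛ (pairFst (pairInl e)))) := by
  rw [permModule_permBasis, permModule_permBasis]
  congr 1
  refine Tabloid.smul_congr fun a ha => ?_
  obtain ⟨i, rfl⟩ := (Tabloid.mem_lower_lift _ _).1 ha
  exact pairSwap_pairInl e ε (i, 1)

theorem permModule_pairSwap_lift_inr [Fintype B] (e : (A ⊕ B) × ℤˣ ↪ N)
    (u : Tabloid Ω.deleteFirstRow B) (ε : A ⊕ B → ℤˣ) :
    permModule Ω N (pairSwap e ε) (permBasis Ω N (u.lift hΩ (pairFst (pairInr e)))) =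
      permModule Ω N (pairSwap (pairInr e) (ε ∘ Sum.inr))
        (permBasis Ω N (u.lift hΩ (pairFst (pairInr e)))) := by
  rw [permModule_permBasis, permModule_permBasis]
  congr 1
  refine Tabloid.smul_congr fun a ha => ?_
  obtain ⟨i, rfl⟩ := (Tabloid.mem_lower_lift _ _).1 ha
  exact pairSwap_pairInr e ε (i, 1)

variable [DecidableEq N]

theorem card_lower_union_le (t : Tabloid Λ N) (u : Tabloid Ω N) :
    (t.lower ∪ u.lower).card ≤ Λ.deleteFirstRow.card + Ω.deleteFirstRow.card := by
  rw [← t.card_lower, ← u.card_lower]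
  exact Finset.card_union_le _ _

theorem tprod_permModule_tmul_eq_self (t : Tabloid Λ N) (u : Tabloid Ω N) {g : Perm N}
    (hg : ∀ a ∈ t.lower ∪ u.lower, g a = a) :
    (permModule Λ N).tprod (permModule Ω N) g (permBasis Λ N t ⊗ₜ[ℂ] permBasis Ω N u) =
      permBasis Λ N t ⊗ₜ[ℂ] permBasis Ω N u := by
  rw [tprod_permModule_tmul,
    Tabloid.smul_eq_self fun a ha => hg a (Finset.mem_union_left _ ha),
    Tabloid.smul_eq_self fun a ha => hg a (Finset.mem_union_right _ ha)]

variable [Fintype A] [DecidableEq A] [Fintype B] [DecidableEq B]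

/-- The antisymmetrization of a pair of tabloids vanishes unless, after exchanges in the pairs, the
entries below the first rows of the two tabloids are complementary sets of first members of pairs.
Permuting the pairs, these sets become the two summands. -/
theorem exists_pairAlt_tmul_permBasis (hΛ : Λ.card = Fintype.card N)
    (hΩ : Ω.card = Fintype.card N) (e : (A ⊕ B) × ℤˣ ↪ N)
    (hA : Fintype.card A = Λ.deleteFirstRow.card) (hB : Fintype.card B = Ω.deleteFirstRow.card)
    (t : Tabloid Λ N) (u : Tabloid Ω N) :
    ∃ (c : ℂ) (π : Perm (A ⊕ B)) (v : MonoidAlgebra ℂ (Tabloid Λ N))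
      (w : MonoidAlgebra ℂ (Tabloid Ω N)),
      pairAlt ((permModule Λ N).tprod (permModule Ω N)) e
          (permBasis Λ N t ⊗ₜ[ℂ] permBasis Ω N u) =
        c • (permModule Λ N).tprod (permModule Ω N) (pairPerm e π)
          (pairAlt (permModule Λ N) (pairInl e) v ⊗ₜ[ℂ]
            pairAlt (permModule Ω N) (pairInr e) w) := by
  classical
  rcases pairAlt_eq_zero_or ((permModule Λ N).tprod (permModule Ω N)) e
    (permBasis Λ N t ⊗ₜ[ℂ] permBasis Ω N u) (t.lower ∪ u.lower)
    (by rw [Fintype.card_sum, hA, hB]; exact card_lower_union_le t u)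
    (fun g hg => tprod_permModule_tmul_eq_self t u hg) with h | ⟨ε, h, hε1, hε2⟩
  · exact ⟨0, 1, 0, 0, by rw [h, zero_smul]⟩
  set s := pairSwap e ε with hs
  set x := pairFst e with hx
  have hmem : ∀ k, x k ∈ (s • t).lower ∨ x k ∈ (s • u).lower := by
    intro k
    obtain ⟨a, ha, hak⟩ := hε2 k
    rw [hx, pairFst_apply, ← hak, Tabloid.smul_mem_lower, Tabloid.smul_mem_lower]
    exact Finset.mem_union.1 ha
  have hran : ∀ b, b ∈ (s • t).lower ∨ b ∈ (s • u).lower → ∃ k, x k = b := by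
    intro b hb
    obtain ⟨a, rfl⟩ := s.surjective b
    rw [Tabloid.smul_mem_lower, Tabloid.smul_mem_lower, ← Finset.mem_union] at hb
    obtain ⟨k, hk⟩ := hε1 a hb
    exact ⟨k, hk.symm⟩
  have hpre : ∀ L : Finset N, (∀ b ∈ L, ∃ k, x k = b) →
      (Finset.univ.filter fun k => x k ∈ L).card = L.card := by
    intro L hL
    rw [← Finset.card_map x]
    congr 1
    ext b
    simp only [Finset.mem_map, Finset.mem_filter, Finset.mem_univ, true_and]
    constructor
    · rintro ⟨k, hk, rfl⟩
      exact hk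
    · intro hb
      obtain ⟨k, rfl⟩ := hL b hb
      exact ⟨k, hb, rfl⟩
  have hcardt := hpre (s • t).lower fun b hb => hran b (Or.inl hb)
  have hcardu := hpre (s • u).lower fun b hb => hran b (Or.inr hb)
  rw [Tabloid.card_lower] at hcardt hcardu
  have hcompl := Finset.card_filter_add_card_filter_not
    (s := (Finset.univ : Finset (A ⊕ B))) (fun k => x k ∈ (s • t).lower)
  rw [hcardt, Finset.card_univ, Fintype.card_sum, hA, hB] at hcompl
  -- every first member of a pair is below the first row in exactly one of the two tabloids
  have hdisj : ∀ k, x k ∈ (s • u).lower ↔ x k ∉ (s • t).lower := by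
    have hsub : (Finset.univ.filter fun k => ¬ x k ∈ (s • t).lower) ⊆
        Finset.univ.filter fun k => x k ∈ (s • u).lower := by
      intro k hk
      simp only [Finset.mem_filter, Finset.mem_univ, true_and] at hk ⊢
      exact (hmem k).resolve_left hk
    have heq := Finset.eq_of_subset_of_card_le hsub (by omega)
    intro k
    have := Finset.ext_iff.1 heq k
    simpa using this.symm
  obtain ⟨fA⟩ : Nonempty (A ≃ {k // x k ∈ (s • t).lower}) :=
    ⟨Fintype.equivOfCardEq (by rw [Fintype.card_subtype, hcardt, hA])⟩
  obtain ⟨fB⟩ : Nonempty (B ≃ {k // ¬ x k ∈ (s • t).lower}) :=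
    ⟨Fintype.equivOfCardEq (by rw [Fintype.card_subtype, hB]; omega)⟩
  set π : Perm (A ⊕ B) := (Equiv.sumCongr fA fB).trans (Equiv.sumCompl _) with hπ
  have hπl : ∀ i, x (π (Sum.inl i)) ∈ (s • t).lower := fun i => by
    simpa [hπ] using (fA i).2
  have hπr : ∀ i, x (π (Sum.inr i)) ∉ (s • t).lower := fun i => by
    simpa [hπ] using (fB i).2
  have hxπ : ∀ k, pairPerm e π (x k) = x (π k) := fun k => pairPerm_apply e π k 1
  obtain ⟨t₀, ht₀⟩ := Tabloid.exists_lift_eq hΛ (pairFst (pairInl e)) hA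
    ((pairPerm e π)⁻¹ • s • t) fun a ha => by
      obtain ⟨b, rfl⟩ := ((pairPerm e π)⁻¹).surjective a
      rw [Tabloid.smul_mem_lower] at ha
      obtain ⟨k, rfl⟩ := hran b (Or.inl ha)
      obtain ⟨k | k, rfl⟩ := π.surjective k
      · refine ⟨k, ?_⟩
        rw [← hxπ, Perm.inv_def, symm_apply_apply]
        rfl
      · exact absurd ha (hπr k)
  obtain ⟨u₀, hu₀⟩ := Tabloid.exists_lift_eq hΩ (pairFst (pairInr e)) hB
    ((pairPerm e π)⁻¹ • s • u) fun a ha => by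
      obtain ⟨b, rfl⟩ := ((pairPerm e π)⁻¹).surjective a
      rw [Tabloid.smul_mem_lower] at ha
      obtain ⟨k, rfl⟩ := hran b (Or.inr ha)
      obtain ⟨k | k, rfl⟩ := π.surjective k
      · exact absurd (hπl k) ((hdisj _).1 ha)
      · refine ⟨k, ?_⟩
        rw [← hxπ, Perm.inv_def, symm_apply_apply]
        rfl
  refine ⟨((Perm.sign s : ℤ) : ℂ), π, permBasis _ _ (t₀.lift hΛ (pairFst (pairInl e))),
    permBasis _ _ (u₀.lift hΩ (pairFst (pairInr e))), h.trans ?_⟩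
  rw [← pairAlt_tmul (permModule_pairSwap_lift_inl hΛ e t₀)
    (permModule_pairSwap_lift_inr hΩ e u₀), ← pairAlt_pairPerm, ht₀, hu₀,
    tprod_permModule_tmul, tprod_permModule_tmul, smul_inv_smul, smul_inv_smul]

/-- Antisymmetrizing the vectors fixed by the permutations fixing the first members of the pairs
gives all pair-alternating vectors of the tensor product. -/
theorem pairAlt_tprod_permModule_mem {K : Type} [Fintype K] [DecidableEq K] (e : K × ℤˣ ↪ N)
    (hK : Fintype.card K = Λ.deleteFirstRow.card + Ω.deleteFirstRow.card) (m) :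
    pairAlt ((permModule Λ N).tprod (permModule Ω N)) e m ∈
      (letterFixed ((permModule Λ N).tprod (permModule Ω N)) (pairFst e)).map
        (pairAlt ((permModule Λ N).tprod (permModule Ω N)) e) := by
  refine tmul_permBasis_le (Q := Submodule.comap
    (pairAlt ((permModule Λ N).tprod (permModule Ω N)) e) (Submodule.map _ _)) (fun t u => ?_) m
  rw [Submodule.mem_comap]
  rcases pairAlt_eq_zero_or ((permModule Λ N).tprod (permModule Ω N)) e
    (permBasis Λ N t ⊗ₜ[ℂ] permBasis Ω N u) (t.lower ∪ u.lower)
    (by rw [hK]; exact card_lower_union_le t u)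
    (fun g hg => tprod_permModule_tmul_eq_self t u hg) with h | ⟨ε, h, hε, -⟩
  · rw [h]
    exact Submodule.zero_mem _
  · rw [h]
    refine Submodule.smul_mem _ _ (Submodule.mem_map_of_mem fun g hg => ?_)
    rw [tprod_permModule_tmul]
    refine tprod_permModule_tmul_eq_self _ _ fun a ha => ?_
    obtain ⟨b, rfl⟩ := (pairSwap e ε).surjective a
    rw [Finset.mem_union, Tabloid.smul_mem_lower, Tabloid.smul_mem_lower, ← Finset.mem_union] at ha
    obtain ⟨i, hi⟩ := hε b ha
    rw [hi]
    exact hg i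

/-! ### Tensor products of Specht modules -/

/-- The tensor product of the inclusions of `S^λ` and `S^ω` into `S^Λ` and `S^Ω`, where `λ` and `ω`
are `Λ` and `Ω` without their first rows. -/
noncomputable def spechtLiftTensor (e : (A ⊕ B) × ℤˣ ↪ N)
    (hA : Fintype.card A = Λ.deleteFirstRow.card) (hB : Fintype.card B = Ω.deleteFirstRow.card) :
    (spechtSub Λ.deleteFirstRow A).toSubmodule ⊗[ℂ] (spechtSub Ω.deleteFirstRow B).toSubmodule
      →ₗ[ℂ] (spechtSub Λ N).toSubmodule ⊗[ℂ] (spechtSub Ω N).toSubmodule :=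
  TensorProduct.map (spechtLift hΛ (pairInl e) hA) (spechtLift hΩ (pairInr e) hB)

variable (e : (A ⊕ B) × ℤˣ ↪ N) (hA : Fintype.card A = Λ.deleteFirstRow.card)
  (hB : Fintype.card B = Ω.deleteFirstRow.card)

theorem tprod_specht_spechtLiftTensor (x : Perm A × Perm B) (w) :
    (specht Λ N).tprod (specht Ω N) (pairPerm e (Perm.sumCongrHom A B x))
        (spechtLiftTensor hΛ hΩ e hA hB w) =
      spechtLiftTensor hΛ hΩ e hA hB
        (externalTensor (specht Λ.deleteFirstRow A) (specht Ω.deleteFirstRow B) x w) := by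
  have : (specht Λ N).tprod (specht Ω N) (pairPerm e (Perm.sumCongrHom A B x)) ∘ₗ
      spechtLiftTensor hΛ hΩ e hA hB = spechtLiftTensor hΛ hΩ e hA hB ∘ₗ
        externalTensor (specht Λ.deleteFirstRow A) (specht Ω.deleteFirstRow B) x := by
    refine TensorProduct.ext' fun v w => ?_
    have h1 : specht Λ N (pairPerm e (Perm.sumCongrHom A B x)) (spechtLift hΛ (pairInl e) hA v) =
        spechtLift hΛ (pairInl e) hA (specht _ A x.1 v) := by
      rw [← specht_pairPerm_spechtLift]
      exact Subtype.ext (permModule_altLift_congr hΛ (pairInl e) (pairPerm_pairInl e x) v)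
    have h2 : specht Ω N (pairPerm e (Perm.sumCongrHom A B x)) (spechtLift hΩ (pairInr e) hB w) =
        spechtLift hΩ (pairInr e) hB (specht _ B x.2 w) := by
      rw [← specht_pairPerm_spechtLift]
      exact Subtype.ext (permModule_altLift_congr hΩ (pairInr e) (pairPerm_pairInr e x) w)
    exact congrArg₂ (fun a b => a ⊗ₜ[ℂ] b) h1 h2
  exact LinearMap.congr_fun this w

theorem isPairAlternating_spechtLiftTensor (w) :
    IsPairAlternating ((specht Λ N).tprod (specht Ω N)) e (spechtLiftTensor hΛ hΩ e hA hB w) := by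
  intro ε
  have : (specht Λ N).tprod (specht Ω N) (pairSwap e ε) ∘ₗ spechtLiftTensor hΛ hΩ e hA hB =
      ((Perm.sign (pairSwap e ε) : ℤ) : ℂ) • spechtLiftTensor hΛ hΩ e hA hB := by
    refine TensorProduct.ext' fun v w => ?_
    exact IsPairAlternating.tmul (isPairAlternating_spechtLift hΛ (pairInl e) hA v)
      (isPairAlternating_spechtLift hΩ (pairInr e) hB w)
      (fun ε => Subtype.ext (permModule_altLift_congr hΛ (pairInl e) (pairSwap_pairInl e ε) v))
      (fun ε => Subtype.ext (permModule_altLift_congr hΩ (pairInr e) (pairSwap_pairInr e ε) w)) ε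
  exact LinearMap.congr_fun this w

/-- Deleting first rows kills the translates of the copy of `S^λ ⊠ S^ω` by permutations of the pairs
that do not preserve the two summands.  So it tells this copy apart from its translates. -/
theorem unlift_tensor_detect {h : Perm (A ⊕ B)} (hh : h ∉ (Perm.sumCongrHom A B).range) (w) :
    TensorProduct.map (unliftMap hΛ (pairFst (pairInl e)) ∘ₗ (spechtSub Λ N).toSubmodule.subtype)
        (unliftMap hΩ (pairFst (pairInr e)) ∘ₗ (spechtSub Ω N).toSubmodule.subtype)
      ((specht Λ N).tprod (specht Ω N) (pairPerm e h) (spechtLiftTensor hΛ hΩ e hA hB w)) = 0 := by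
  -- some index `i` of the first summand is not the image under `h` of such an index
  obtain ⟨i, hi⟩ : ∃ i, ∀ j, h (Sum.inl j) ≠ Sum.inl i := by
    by_contra! hc
    refine hh ?_
    rw [← (Perm.sumCongrHom A B).range.inv_mem_iff]
    refine Perm.mem_sumCongrHom_range_of_perm_mapsTo_inl ?_
    rintro _ ⟨i, rfl⟩
    obtain ⟨j, hj⟩ := hc i
    exact ⟨j, by rw [← hj, Perm.inv_def, symm_apply_apply]⟩
  have : TensorProduct.map
        (unliftMap hΛ (pairFst (pairInl e)) ∘ₗ (spechtSub Λ N).toSubmodule.subtype)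
        (unliftMap hΩ (pairFst (pairInr e)) ∘ₗ (spechtSub Ω N).toSubmodule.subtype) ∘ₗ
      (specht Λ N).tprod (specht Ω N) (pairPerm e h) ∘ₗ spechtLiftTensor hΛ hΩ e hA hB = 0 := by
    refine TensorProduct.ext' fun v w => ?_
    change unliftMap hΛ (pairFst (pairInl e)) (permModule Λ N (pairPerm e h)
      (altLift hΛ (pairInl e) v)) ⊗ₜ[ℂ] _ = 0
    rw [unliftMap_permModule_altLift_eq_zero (i := i), TensorProduct.zero_tmul]
    rintro ⟨j, u⟩ hj
    rw [pairInl_apply, pairPerm_apply, pairInl_apply] at hj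
    exact hi j (congrArg Prod.fst (e.injective hj))
  exact LinearMap.congr_fun this w

theorem unlift_tensor_spechtLiftTensor (w) :
    TensorProduct.map (unliftMap hΛ (pairFst (pairInl e)) ∘ₗ (spechtSub Λ N).toSubmodule.subtype)
        (unliftMap hΩ (pairFst (pairInr e)) ∘ₗ (spechtSub Ω N).toSubmodule.subtype)
      (spechtLiftTensor hΛ hΩ e hA hB w) =
    TensorProduct.map (spechtSub Λ.deleteFirstRow A).toSubmodule.subtype
      (spechtSub Ω.deleteFirstRow B).toSubmodule.subtype w := by
  have : TensorProduct.map
        (unliftMap hΛ (pairFst (pairInl e)) ∘ₗ (spechtSub Λ N).toSubmodule.subtype)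
        (unliftMap hΩ (pairFst (pairInr e)) ∘ₗ (spechtSub Ω N).toSubmodule.subtype) ∘ₗ
      spechtLiftTensor hΛ hΩ e hA hB = TensorProduct.map
        (spechtSub Λ.deleteFirstRow A).toSubmodule.subtype
        (spechtSub Ω.deleteFirstRow B).toSubmodule.subtype :=
    TensorProduct.ext' fun v w => congrArg₂ (fun a b => a ⊗ₜ[ℂ] b)
      (unliftMap_altLift hΛ (pairInl e) v) (unliftMap_altLift hΩ (pairInr e) w)
  exact LinearMap.congr_fun this w

theorem subtype_tensor_injective (Λ Ω : YoungDiagram) (A B : Type) [Fintype A] [DecidableEq A]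
    [Fintype B] [DecidableEq B] :
    Function.Injective (TensorProduct.map (spechtSub Λ A).toSubmodule.subtype
      (spechtSub Ω B).toSubmodule.subtype) :=
  TensorProduct.map_injective_of_flat_flat _ _ (Submodule.injective_subtype _)
    (Submodule.injective_subtype _)

theorem exists_retraction_tprod_specht (Λ Ω : YoungDiagram) (N : Type) [Fintype N]
    [DecidableEq N] :
    ∃ (p : MonoidAlgebra ℂ (Tabloid Λ N) →ₗ[ℂ] (spechtSub Λ N).toSubmodule)
      (q : MonoidAlgebra ℂ (Tabloid Ω N) →ₗ[ℂ] (spechtSub Ω N).toSubmodule),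
      (∀ g v, p (permModule Λ N g v) = specht Λ N g (p v)) ∧
      (∀ g w, q (permModule Ω N g w) = specht Ω N g (q w)) ∧
      (∀ g m, TensorProduct.map p q ((permModule Λ N).tprod (permModule Ω N) g m) =
        (specht Λ N).tprod (specht Ω N) g (TensorProduct.map p q m)) ∧
      Function.Surjective (TensorProduct.map p q) := by
  obtain ⟨p, hp, hpS⟩ := (spechtSub Λ N).exists_equivariant_retraction
  obtain ⟨q, hq, hqS⟩ := (spechtSub Ω N).exists_equivariant_retraction
  have hpsurj : Function.Surjective p := fun v => ⟨v, hpS v⟩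
  have hqsurj : Function.Surjective q := fun w => ⟨w, hqS w⟩
  refine ⟨p, q, hp, hq, fun g m => ?_, TensorProduct.map_surjective hpsurj hqsurj⟩
  have : TensorProduct.map p q ∘ₗ (permModule Λ N).tprod (permModule Ω N) g =
      (specht Λ N).tprod (specht Ω N) g ∘ₗ TensorProduct.map p q :=
    TensorProduct.ext' fun v w => congrArg₂ (fun a b => a ⊗ₜ[ℂ] b) (hp g v) (hq g w)
  exact LinearMap.congr_fun this m

theorem exists_spechtLift_eq {μ : YoungDiagram} {K : Type} [Fintype K] [DecidableEq K]
    (hN : μ.card = Fintype.card N) (e : K × ℤˣ ↪ N)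
    (hK : Fintype.card K = μ.deleteFirstRow.card) (v : (spechtSub μ N).toSubmodule) :
    ∃ u, pairAlt (specht μ N) e v = spechtLift hN e hK u := by
  obtain ⟨u, hu, hvu⟩ := exists_pairAlt_eq_altLift_of_mem hN e hK v.2
  refine ⟨⟨u, hu⟩, Subtype.ext ?_⟩
  rw [coe_spechtLift, ← hvu]
  exact map_pairAlt (spechtSub μ N).toSubmodule.subtype (fun _ _ => rfl) e v

/-- The pair-alternating vectors of `S^Λ ⊗ S^Ω` are spanned by the translates of the copy of
`S^λ ⊠ S^ω`. -/
theorem pairAlt_tprod_specht_mem_of_translates {Q : Submodule ℂ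
      ((spechtSub Λ N).toSubmodule ⊗[ℂ] (spechtSub Ω N).toSubmodule)}
    (hQ : ∀ π w, (specht Λ N).tprod (specht Ω N) (pairPerm e π)
      (spechtLiftTensor hΛ hΩ e hA hB w) ∈ Q)
    (v : (spechtSub Λ N).toSubmodule ⊗[ℂ] (spechtSub Ω N).toSubmodule) :
    pairAlt ((specht Λ N).tprod (specht Ω N)) e v ∈ Q := by
  obtain ⟨p, q, hp, hq, hpq, hpqsurj⟩ := exists_retraction_tprod_specht Λ Ω N
  obtain ⟨m, rfl⟩ := hpqsurj v
  refine tmul_permBasis_le (Q := Submodule.comap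
    (pairAlt ((specht Λ N).tprod (specht Ω N)) e ∘ₗ TensorProduct.map p q) Q) (fun t u => ?_) m
  rw [Submodule.mem_comap, LinearMap.comp_apply, ← map_pairAlt (TensorProduct.map p q) hpq]
  obtain ⟨c, π, v, w, h⟩ := exists_pairAlt_tmul_permBasis hΛ hΩ e hA hB t u
  obtain ⟨v', hv'⟩ := exists_spechtLift_eq hΛ (pairInl e) hA (p v)
  obtain ⟨w', hw'⟩ := exists_spechtLift_eq hΩ (pairInr e) hB (q w)
  rw [h, map_smul, hpq, TensorProduct.map_tmul, map_pairAlt p hp, map_pairAlt q hq, hv', hw']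
  exact Submodule.smul_mem _ _ (hQ π (v' ⊗ₜ[ℂ] w'))

/-- The statement of `pairAlt_tprod_permModule_mem` passes to `S^Λ ⊗ S^Ω`, which is an equivariant
quotient of `M^Λ ⊗ M^Ω`. -/
theorem pairAlt_tprod_specht_mem {K : Type} [Fintype K] [DecidableEq K] (e : K × ℤˣ ↪ N)
    (hK : Fintype.card K = Λ.deleteFirstRow.card + Ω.deleteFirstRow.card)
    (v : (spechtSub Λ N).toSubmodule ⊗[ℂ] (spechtSub Ω N).toSubmodule) :
    pairAlt ((specht Λ N).tprod (specht Ω N)) e v ∈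
      (letterFixed ((specht Λ N).tprod (specht Ω N)) (pairFst e)).map
        (pairAlt ((specht Λ N).tprod (specht Ω N)) e) := by
  obtain ⟨p, q, -, -, hpq, hpqsurj⟩ := exists_retraction_tprod_specht Λ Ω N
  obtain ⟨m, rfl⟩ := hpqsurj v
  obtain ⟨w, hw, hwm⟩ := pairAlt_tprod_permModule_mem e hK m
  refine ⟨TensorProduct.map p q w, fun g hg => ?_, ?_⟩
  · rw [← hpq, hw g hg]
  · rw [← map_pairAlt (TensorProduct.map p q) hpq, hwm, map_pairAlt (TensorProduct.map p q) hpq]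

/-- The multiplicity of a Specht module in a tensor product of Specht modules, when the diagram
has as many cells below the first row as the two factors together. -/
theorem repMultiplicity_tprod_specht_eq {S : YoungDiagram}
    (hΛ : Λ.card = Fintype.card N) (hΩ : Ω.card = Fintype.card N) (hS : S.card = Fintype.card N)
    (e : (A ⊕ B) × ℤˣ ↪ N) (hA : Fintype.card A = Λ.deleteFirstRow.card)
    (hB : Fintype.card B = Ω.deleteFirstRow.card)
    (hAB : S.deleteFirstRow.card = Λ.deleteFirstRow.card + Ω.deleteFirstRow.card) :
    repMultiplicity (specht S N) ((specht Λ N).tprod (specht Ω N)) =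
      repMultiplicity (specht S.deleteFirstRow (A ⊕ B))
        (Representation.ind
          (A := TensorProduct ℂ (spechtSub Λ.deleteFirstRow A).toSubmodule
            (spechtSub Ω.deleteFirstRow B).toSubmodule)
          (Perm.sumCongrHom A B)
          (externalTensor (specht Λ.deleteFirstRow A) (specht Ω.deleteFirstRow B))) := by
  have hK : Fintype.card (A ⊕ B) = Λ.deleteFirstRow.card + Ω.deleteFirstRow.card := by
    rw [Fintype.card_sum, hA, hB]
  refine repMultiplicity_specht_eq_ind_externalTensor
    (X₁ := (spechtSub Λ.deleteFirstRow A).toSubmodule)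
    (X₂ := (spechtSub Ω.deleteFirstRow B).toSubmodule)
    (V := (spechtSub Λ N).toSubmodule ⊗[ℂ] (spechtSub Ω N).toSubmodule)
    (Y := MonoidAlgebra ℂ (Tabloid Λ.deleteFirstRow A) ⊗[ℂ]
      MonoidAlgebra ℂ (Tabloid Ω.deleteFirstRow B))
    hS e ((specht Λ N).tprod (specht Ω N)) (hK.trans hAB.symm) ?_
    (Perm.sumCongrHom A B) Perm.sumCongrHom_injective
    (specht Λ.deleteFirstRow A) (specht Ω.deleteFirstRow B)
    (spechtLiftTensor hΛ hΩ e hA hB) ?_ ?_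
    (TensorProduct.map (unliftMap hΛ (pairFst (pairInl e)) ∘ₗ (spechtSub Λ N).toSubmodule.subtype)
      (unliftMap hΩ (pairFst (pairInr e)) ∘ₗ (spechtSub Ω N).toSubmodule.subtype))
    (TensorProduct.map (spechtSub Λ.deleteFirstRow A).toSubmodule.subtype
      (spechtSub Ω.deleteFirstRow B).toSubmodule.subtype) ?_ ?_ ?_ ?_
  · exact pairAlt_tprod_specht_mem e hK
  · exact tprod_specht_spechtLiftTensor hΛ hΩ e hA hB
  · exact isPairAlternating_spechtLiftTensor hΛ hΩ e hA hB
  · exact subtype_tensor_injective _ _ _ _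
  · exact fun h hh => unlift_tensor_detect hΛ hΩ e hA hB hh
  · exact unlift_tensor_spechtLiftTensor hΛ hΩ e hA hB
  · exact fun Q hQ => pairAlt_tprod_specht_mem_of_translates hΛ hΩ e hA hB hQ

/-! ### Diagrams with a short first row -/

/-- A Specht module does not occur in `S^Λ ⊗ S^Ω` if its first row is shorter than the number of
letters that stand in the first rows of both tabloids of a pair: two such letters lie in one column,
and their transposition would change the sign of a coefficient that it fixes. -/
theorem repMultiplicity_tprod_specht_eq_zero {S : YoungDiagram}
    (h : S.rowLen 0 + (Λ.deleteFirstRow.card + Ω.deleteFirstRow.card) < Fintype.card N) :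
    repMultiplicity (specht S N) ((specht Λ N).tprod (specht Ω N)) = 0 := by
  have hsub : ∀ φ : Representation.IntertwiningMap (specht S N)
      ((specht Λ N).tprod (specht Ω N)), φ = 0 := by
    intro φ
    set J := TensorProduct.map (spechtSub Λ N).toSubmodule.subtype
      (spechtSub Ω N).toSubmodule.subtype with hJ
    have hJequi : ∀ g v, J ((specht Λ N).tprod (specht Ω N) g v) =
        (permModule Λ N).tprod (permModule Ω N) g (J v) := by
      intro g v
      have : J ∘ₗ (specht Λ N).tprod (specht Ω N) g =
          (permModule Λ N).tprod (permModule Ω N) g ∘ₗ J := TensorProduct.ext' fun _ _ => rfl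
      exact LinearMap.congr_fun this v
    have hpoly : ∀ T : N ≃ S.cells, φ ⟨polytabloid T, polytabloid_mem T⟩ = 0 := by
      intro T
      set m := J (φ ⟨polytabloid T, polytabloid_mem T⟩) with hm
      refine subtype_tensor_injective Λ Ω N N ?_
      rw [map_zero]
      refine ((permBasis Λ N).tensorProduct (permBasis Ω N)).ext_elem fun ⟨t, u⟩ => ?_
      rw [map_zero, Finsupp.zero_apply]
      obtain ⟨a, ha, b, hb, hab, hcol⟩ := Finset.exists_ne_map_eq_of_card_lt_of_maps_to
        (s := (t.lower ∪ u.lower)ᶜ) (t := Finset.range (S.rowLen 0)) (f := fun a => (T a).1.2) (by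
          have := card_lower_union_le t u
          rw [Finset.card_range, Finset.card_compl]
          omega) (fun a _ => by
          have h1 : (0, (T a).1.2) ∈ S :=
            S.up_left_mem (Nat.zero_le _) le_rfl ((mem_cells _).1 (T a).2)
          exact Finset.mem_coe.2 (Finset.mem_range.2 (mem_iff_lt_rowLen.1 h1)))
      rw [Finset.mem_compl, Finset.mem_union, not_or] at ha hb
      have hfix : ∀ {ν : YoungDiagram} (r : Tabloid ν N), a ∉ r.lower → b ∉ r.lower →
          swap a b • r = r := by
        intro ν r har hbr
        refine Tabloid.smul_eq_self fun c hc => swap_apply_of_ne_of_ne ?_ ?_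
        · rintro rfl
          exact har hc
        · rintro rfl
          exact hbr hc
      have hcoord : ∀ m, ((permBasis Λ N).tensorProduct (permBasis Ω N)).coord (t, u)
          ((permModule Λ N).tprod (permModule Ω N) (swap a b) m) =
            ((permBasis Λ N).tensorProduct (permBasis Ω N)).coord (t, u) m := by
        intro m
        have : ((permBasis Λ N).tensorProduct (permBasis Ω N)).coord (t, u) ∘ₗ
            (permModule Λ N).tprod (permModule Ω N) (swap a b) =
            ((permBasis Λ N).tensorProduct (permBasis Ω N)).coord (t, u) := by
          refine TensorProduct.ext' fun v w => ?_
          rw [LinearMap.comp_apply, Representation.tprod_apply, TensorProduct.map_tmul,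
            Module.Basis.coord_apply, Module.Basis.coord_apply,
            Module.Basis.tensorProduct_repr_tmul_apply,
            Module.Basis.tensorProduct_repr_tmul_apply]
          simp only [permBasis_repr, Representation.coeff_ofMulAction, swap_inv]
          rw [hfix t ha.1 hb.1, hfix u ha.2 hb.2]
        exact LinearMap.congr_fun this m
      have hneg : (permModule Λ N).tprod (permModule Ω N) (swap a b) m = -m := by
        have h1 : specht S N (swap a b) ⟨polytabloid T, polytabloid_mem T⟩ =
            -⟨polytabloid T, polytabloid_mem T⟩ := by
          refine Subtype.ext ?_
          rw [coe_specht, permModule_polytabloid_of_mem (swap_mem_columnGroup hcol),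
            Perm.sign_swap hab]
          simp
        rw [hm, ← hJequi, ← φ.isIntertwining, h1, map_neg, map_neg]
      have h2 := hcoord m
      rw [hneg, map_neg] at h2
      change ((permBasis Λ N).tensorProduct (permBasis Ω N)).coord (t, u) m = 0
      exact CharZero.neg_eq_self_iff.1 h2
    refine Representation.IntertwiningMap.ext (LinearMap.ext fun v => ?_)
    obtain ⟨v, hv⟩ := v
    refine Submodule.span_induction (p := fun v hv => φ ⟨v, hv⟩ = 0) ?_ ?_ ?_ ?_ hv
    · rintro _ ⟨T, rfl⟩
      exact hpoly T
    · exact map_zero φ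
    · intro x y hx hy hx0 hy0
      have := map_add φ ⟨x, hx⟩ ⟨y, hy⟩
      rwa [hx0, hy0, add_zero] at this
    · intro c x hx hx0
      have := map_smul φ c ⟨x, hx⟩
      rwa [hx0, smul_zero] at this
  have : Subsingleton (Representation.IntertwiningMap (specht S N)
      ((specht Λ N).tprod (specht Ω N))) := ⟨fun φ ψ => (hsub φ).trans (hsub ψ).symm⟩
  exact Module.finrank_zero_of_subsingleton

end

end YoungDiagram

theorem proposition1p3 (n : ℕ) (Λ Ω : YoungDiagram) (hΛ : Λ.card = n) (hΩ : Ω.card = n)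
    (h : 2 * (Λ.deleteFirstRow.card + Ω.deleteFirstRow.card) ≤ n) :
    (∀ S : YoungDiagram, S.card = n →
      S.rowLen 0 < n - (Λ.deleteFirstRow.card + Ω.deleteFirstRow.card) →
      kroneckerCoeff n Λ Ω S = 0) ∧
    (∀ S : YoungDiagram, S.card = n →
      S.rowLen 0 = n - (Λ.deleteFirstRow.card + Ω.deleteFirstRow.card) →
      S.deleteFirstRow.card = Λ.deleteFirstRow.card + Ω.deleteFirstRow.card ∧
      kroneckerCoeff n Λ Ω S =
        littlewoodRichardsonCoeff Λ.deleteFirstRow Ω.deleteFirstRow S.deleteFirstRow) := by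
  refine ⟨fun S _ hrow => ?_, fun S hS hrow => ?_⟩
  · refine YoungDiagram.repMultiplicity_tprod_specht_eq_zero ?_
    rw [Fintype.card_fin]
    omega
  · have hdel : S.deleteFirstRow.card = Λ.deleteFirstRow.card + Ω.deleteFirstRow.card := by
      have := S.rowLen_zero_add_card_deleteFirstRow
      omega
    refine ⟨hdel, ?_⟩
    obtain ⟨e⟩ : Nonempty ((Fin Λ.deleteFirstRow.card ⊕ Fin Ω.deleteFirstRow.card) × ℤˣ ↪ Fin n) :=
      Function.Embedding.nonempty_of_card_le (by simp; omega)
    exact YoungDiagram.repMultiplicity_tprod_specht_eq (by simpa using hΛ) (by simpa using hΩ)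
      (by simpa using hS) e (by simp) (by simp) hdel
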